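/- Let $\mathbb D^*=\{w\in\mathbb C: 0<|w|<1\}$ and let $d\sigma^2$ be a smooth ($C^\infty$) conformal metric of constant Gaussian curvature $-1$ on $\mathbb D^*$. A complex coordinate $z$ on an open neighbourhood $U$ of $0$ means an injective holomorphic function $z:U\to\mathbb C$; it is centred at $0$ if $z(0)=0$. Say that $d\sigma^2$ has a conical singularity at $0$ with cone angle $2\pi\alpha>0$ if on some neighbourhood $U\subset\{|w|<1\}$ of $0$ there is a complex coordinate $z$ centred at $0$ such that $d\sigma^2=e^{2u}|dz|^2$ on $U\setminus\{0\}$ and $u-(\alpha-1)\ln|z|$ extends to a continuous function on $U$. Say that $d\sigma^2$ has a cusp singularity at $0$ if on some such $U$ there is a complex coordinate $z$ centred at $0$, with $|z|<1$, such that $d\sigma^2=e^{2u}|dz|^2$ on $U\setminus\{0\}$ and $u+\ln|z|+\ln(-\ln|z|)$ extends to a continuous function on $U$. Then $0$ is either a conical singularity (for some $\alpha>0$) or a cusp singularity of $d\sigma^2$, and not both. Write $\Delta_\varepsilon=\{w\in\mathbb C:|w|<\varepsilon\}$. (1) If $d\sigma^2$ has a conical singularity at $0$ with angle $2\pi\alpha>0$,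 then for some $0<\varepsilon\le 1$ there is a complex coordinate $z$ on $\Delta_\varepsilon$ with $z(0)=0$ such that on $\Delta_\varepsilon\setminus\{0\}$ $$d\sigma^2=\frac{4\alpha^2|z|^{2\alpha-2}}{\bigl(1-|z|^{2\alpha}\bigr)^2}\,|dz|^2 .$$ (2) If $d\sigma^2$ has a cusp singularity at $0$, then for some $0<\varepsilon\le 1$ there is a complex coordinate $z$ on $\Delta_\varepsilon$ with $z(0)=0$ such that on $\Delta_\varepsilon\setminus\{0\}$ $$d\sigma^2=|z|^{-2}(\ln|z|)^{-2}\,|dz|^2 .$$ In both cases $z$ is unique up to multiplication by a unimodular constant: if $z$ is such a coordinate on $\Delta_\varepsilon$ and $0<\varepsilon'\le\varepsilon$, then the coordinates of this kind on $\Delta_{\varepsilon'}$ are exactly the functions $\lambda z|_{\Delta_{\varepsilon'}}$ with $\lambda\in\mathbb C$, $|\lambda|=1$. -/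

import Mathlib

open scoped ContDiff

/-- The punctured unit disk in the complex plane. -/
def puncturedDisk : Set ℂ := Metric.ball (0 : ℂ) 1 \ {0}

/-- The Gaussian curvature at the point `w` of the conformal metric `ρ(w) |dw|²`.  With
`ρ = e^{2u}` this is the usual `-e^{-2u} Δu`. -/
noncomputable def gaussCurvature (ρ : ℂ → ℝ) (w : ℂ) : ℝ :=
  -(Laplacian.laplacian (fun x : ℂ => Real.log (ρ x)) w) / (2 * ρ w)

/-- `ρ(w) |dw|²` is a smooth conformal metric of constant curvature `-1` on the open set `Ω`.
Only the values of `ρ` on `Ω` matter. -/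
structure IsConformalHyperbolicMetric (ρ : ℂ → ℝ) (Ω : Set ℂ) : Prop where
  smooth : ContDiffOn ℝ ∞ ρ Ω
  pos : ∀ w ∈ Ω, 0 < ρ w
  curvature : ∀ w ∈ Ω, gaussCurvature ρ w = -1

/-- `z` is a complex coordinate on the open neighbourhood `U` of `0` that is centred at `0`:
a biholomorphic map from `U` onto its image, with `z(0) = 0`. -/
structure IsCenteredCoordinate (z : ℂ → ℂ) (U : Set ℂ) : Prop where
  isOpen : IsOpen U
  zero_mem : (0 : ℂ) ∈ U
  holomorphic : DifferentiableOn ℂ z U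
  injective : Set.InjOn z U
  map_zero : z 0 = 0

/-- `ρ(w) |dw|² = τ(w) |dz|²` at every point `w` of `U` other than `0`.  The coefficient `τ` is
written as a function of the point `w`, and `|dz| = |z'(w)| |dw|`. -/
def MetricEqInCoordinate (ρ : ℂ → ℝ) (U : Set ℂ) (z : ℂ → ℂ) (τ : ℂ → ℝ) : Prop :=
  ∀ w ∈ U \ {0}, ρ w = τ w * ‖deriv z w‖ ^ 2

/-- The real function `f`, given on `U \ {0}`, extends to a continuous function on `U`. -/
def ExtendsContinuously (f : ℂ → ℝ) (U : Set ℂ) : Prop :=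
  ∃ g : ℂ → ℝ, ContinuousOn g U ∧ Set.EqOn g f (U \ {0})

/-- The metric `ρ(w) |dw|²` on the punctured unit disk has a conical singularity at `0` with cone
angle `2πα > 0`: near `0` it is `e^{2u} |dz|²` in a coordinate `z` centred at `0`, and
`u - (α - 1) ln |z|` extends continuously over `0`. -/
def HasConicalSingularity (ρ : ℂ → ℝ) (α : ℝ) : Prop :=
  0 < α ∧ ∃ (U : Set ℂ) (z : ℂ → ℂ) (u : ℂ → ℝ),
    U ⊆ Metric.ball (0 : ℂ) 1 ∧ IsCenteredCoordinate z U ∧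
    MetricEqInCoordinate ρ U z (fun w => Real.exp (2 * u w)) ∧
    ExtendsContinuously (fun w => u w - (α - 1) * Real.log ‖z w‖) U

/-- The metric `ρ(w) |dw|²` on the punctured unit disk has a cusp singularity at `0`: near `0` it
is `e^{2u} |dz|²` in a coordinate `z` centred at `0`, and `u + ln |z| + ln (-ln |z|)` (which
presupposes `|z| < 1`) extends continuously over `0`. -/
def HasCuspSingularity (ρ : ℂ → ℝ) : Prop :=
  ∃ (U : Set ℂ) (z : ℂ → ℂ) (u : ℂ → ℝ),
    U ⊆ Metric.ball (0 : ℂ) 1 ∧ IsCenteredCoordinate z U ∧ (∀ w ∈ U, ‖z w‖ < 1) ∧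
    MetricEqInCoordinate ρ U z (fun w => Real.exp (2 * u w)) ∧
    ExtendsContinuously (fun w => u w + Real.log ‖z w‖ + Real.log (-Real.log ‖z w‖)) U

/-- On the disk `|w| < ε` (inside the unit disk) the map `z` is a complex coordinate with
`z(0) = 0` in which the metric is
`4α²|z|^{2α-2} / (1 - |z|^{2α})² |dz|²`. -/
def IsConicalNormalCoordinate (ρ : ℂ → ℝ) (α ε : ℝ) (z : ℂ → ℂ) : Prop :=
  0 < ε ∧ ε ≤ 1 ∧ IsCenteredCoordinate z (Metric.ball 0 ε) ∧
    MetricEqInCoordinate ρ (Metric.ball 0 ε) z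
      (fun w => 4 * α ^ 2 * ‖z w‖ ^ (2 * α - 2) / (1 - ‖z w‖ ^ (2 * α)) ^ 2)

/-- On the disk `|w| < ε` (inside the unit disk) the map `z` is a complex coordinate with
`z(0) = 0` in which the metric is
`|z|^{-2} (ln |z|)^{-2} |dz|²`. -/
def IsCuspNormalCoordinate (ρ : ℂ → ℝ) (ε : ℝ) (z : ℂ → ℂ) : Prop :=
  0 < ε ∧ ε ≤ 1 ∧ IsCenteredCoordinate z (Metric.ball 0 ε) ∧
    MetricEqInCoordinate ρ (Metric.ball 0 ε) z
      (fun w => (‖z w‖ ^ 2)⁻¹ * (Real.log ‖z w‖ ^ 2)⁻¹)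

/-! A hyperbolic metric `e^{2u} |dw|²` on the punctured disk is developed into the hyperbolic
plane, and the singularity is read off from the monodromy of the developing map.

Liouville's equation makes `Q = ∂²u/∂w² - (∂u/∂w)²` holomorphic
(`IsConformalHyperbolicMetric.exists_schwarzian`). On the universal cover `w = e^ζ`, `Re ζ < 0`,
the function `v = e^{-u}` satisfies the linear equation `∂²v/∂ζ² + Q v = 0` and its conjugate, so
it is a Hermitian form in the solutions of `y'' + Q y = 0`; in suitable solutions
`2 v = |y₁|² - |y₂|²` (`LiouvilleSystem.exists_solutions`). Hence the metric is the pull-back of the hyperbolic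
metric of the disk under `y₂ / y₁`, and `ζ ↦ ζ + 2πi` acts on `(y₁, y₂)` by a matrix in `SU(1, 1)`
(`IsConformalHyperbolicMetric.exists_developing_pair`). Global solutions of the linear equation
come from power series on the unit disk and the Cayley transform (`exists_solvesODE`).

This matrix has a fixed point in the closed disk (`exists_fixedPoint`). If it lies inside, the
developing map becomes `f = e^{θζ} h(e^ζ)` with `h` holomorphic at `0`, thus `f = z^α` for a
coordinate `z` (`EllipticDevelopment.exists_conicalNormalCoordinate`). If it lies on the boundary,
there is a developing map `F` to the right half-plane with `F(ζ + 2πi) = k F(ζ) + i b`. For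
`k = 1`, `b ≠ 0` the function `z = exp(-2π F / |b|)` is a coordinate giving the cusp
(`AffineDevelopment.exists_cuspNormalCoordinate`); `k ≠ 1` is impossible since `log F` would
provide a nonvanishing holomorphic function at `0` with nonzero winding number
(`AffineDevelopment.k_eq_one`).

The limit of `log ρ(w) / log |w|` at `0` is `2α - 2` at a conical singularity and `-2` at a cusp,
which separates the cases and determines `α` (`HasConicalSingularity.tendsto`,
`HasCuspSingularity.tendsto`). Uniqueness of the normal coordinate rests on the maximum principle:
both normal forms are `(φ(|z|) / |z|)² |dz|²` with `φ` increasing, and comparing two such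
coordinates at a boundary maximum of `|z₂ / z₁|` gives `|z₂| ≤ |z₁|`
(`eventually_norm_le_of_radial`). -/

open Complex Filter Topology Metric Set
open scoped ComplexConjugate

/-! ### Wirtinger calculus -/

/-- `f` is real-differentiable at `z` with Wirtinger derivatives `∂f/∂z = a` and `∂f/∂z̄ = b`, that
is, with differential `h ↦ a h + b h̄`. -/
def HasWirtingerDerivAt (f : ℂ → ℂ) (a b z : ℂ) : Prop :=
  HasFDerivAt f (a • ContinuousLinearMap.id ℝ ℂ + b • (conjCLE : ℂ →L[ℝ] ℂ)) z

namespace HasWirtingerDerivAt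

variable {f g : ℂ → ℂ} {a b c d z : ℂ}

lemma congr_deriv (hf : HasWirtingerDerivAt f a b z) (ha : a = c) (hb : b = d) :
    HasWirtingerDerivAt f c d z := by subst ha hb; exact hf

lemma congr_fun (hf : HasWirtingerDerivAt f a b z) (h : g =ᶠ[𝓝 z] f) :
    HasWirtingerDerivAt g a b z :=
  HasFDerivAt.congr_of_eventuallyEq hf h

lemma add (hf : HasWirtingerDerivAt f a b z) (hg : HasWirtingerDerivAt g c d z) :
    HasWirtingerDerivAt (fun w => f w + g w) (a + c) (b + d) z := by
  refine (HasFDerivAt.add hf hg).congr_fderiv ?_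
  ext h; simp; ring

lemma neg (hf : HasWirtingerDerivAt f a b z) :
    HasWirtingerDerivAt (fun w => -f w) (-a) (-b) z := by
  refine (HasFDerivAt.neg hf).congr_fderiv ?_
  ext h; simp; ring

lemma sub (hf : HasWirtingerDerivAt f a b z) (hg : HasWirtingerDerivAt g c d z) :
    HasWirtingerDerivAt (fun w => f w - g w) (a - c) (b - d) z := by
  refine (HasFDerivAt.sub hf hg).congr_fderiv ?_
  ext h; simp; ring

lemma mul (hf : HasWirtingerDerivAt f a b z) (hg : HasWirtingerDerivAt g c d z) :
    HasWirtingerDerivAt (fun w => f w * g w) (a * g z + f z * c) (b * g z + f z * d) z := by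
  refine (HasFDerivAt.mul hf hg).congr_fderiv ?_
  ext h; simp; ring

lemma conjugate (hf : HasWirtingerDerivAt f a b z) :
    HasWirtingerDerivAt (fun w => conj (f w)) (conj b) (conj a) z := by
  refine ((conjCLE : ℂ →L[ℝ] ℂ).hasFDerivAt.comp z hf).congr_fderiv ?_
  ext h; simp; ring

lemma const (c z : ℂ) : HasWirtingerDerivAt (fun _ => c) 0 0 z :=
  (hasFDerivAt_const c z).congr_fderiv (by ext h; simp)

lemma of_hasDerivAt (hf : HasDerivAt f a z) : HasWirtingerDerivAt f a 0 z := by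
  refine (hf.hasFDerivAt.restrictScalars ℝ).congr_fderiv ?_
  ext h; simp [mul_comm]

lemma const_mul (k : ℂ) (hf : HasWirtingerDerivAt f a b z) :
    HasWirtingerDerivAt (fun w => k * f w) (k * a) (k * b) z :=
  ((const k z).mul hf).congr_deriv (by simp) (by simp)

/-- Chain rule for a holomorphic outer function. -/
lemma comp_left {φ : ℂ → ℂ} {φ' : ℂ} (hφ : HasDerivAt φ φ' (f z))
    (hf : HasWirtingerDerivAt f a b z) :
    HasWirtingerDerivAt (fun w => φ (f w)) (φ' * a) (φ' * b) z := by
  refine (HasFDerivAt.comp z (hφ.hasFDerivAt.restrictScalars ℝ) hf).congr_fderiv ?_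
  ext h; simp; ring

/-- Chain rule for a holomorphic inner function. -/
lemma comp_right {φ : ℂ → ℂ} {φ' : ℂ} (hf : HasWirtingerDerivAt f a b (φ z))
    (hφ : HasDerivAt φ φ' z) :
    HasWirtingerDerivAt (fun w => f (φ w)) (a * φ') (b * starRingEnd ℂ φ') z := by
  refine (HasFDerivAt.comp z hf (hφ.hasFDerivAt.restrictScalars ℝ)).congr_fderiv ?_
  ext h; simp; ring

lemma hasDerivAt (hf : HasWirtingerDerivAt f a 0 z) : HasDerivAt f a z := by
  have h : HasFDerivAt f ((ContinuousLinearMap.toSpanSingleton ℂ a : ℂ →L[ℂ] ℂ)) z := by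
    refine hasFDerivAt_of_restrictScalars ℝ hf ?_
    ext h; simp [mul_comm]
  exact h

lemma eq_on_convex {s : Set ℂ} (hs : IsOpen s) (hc : Convex ℝ s)
    (hf : ∀ w ∈ s, HasWirtingerDerivAt f 0 0 w) {x y : ℂ} (hx : x ∈ s) (hy : y ∈ s) :
    f x = f y := by
  have h : ∀ w ∈ s, HasFDerivAt f (0 : ℂ →L[ℝ] ℂ) w := fun w hw =>
    HasFDerivAt.congr_fderiv (hf w hw) (by ext h; simp)
  exact hs.is_const_of_fderiv_eq_zero hc.isPreconnected
    (fun w hw => (h w hw).differentiableAt.differentiableWithinAt)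
    (fun w hw => (h w hw).fderiv) hx hy

/-- The Wirtinger derivatives read off from the real differential. -/
lemma of_differentiableAt (hf : DifferentiableAt ℝ f z) :
    HasWirtingerDerivAt f ((fderiv ℝ f z 1 - I * fderiv ℝ f z I) / 2)
      ((fderiv ℝ f z 1 + I * fderiv ℝ f z I) / 2) z := by
  refine hf.hasFDerivAt.congr_fderiv ?_
  ext h
  have hh : h = h.re • (1 : ℂ) + h.im • I := by simp
  have h1 : fderiv ℝ f z h = h.re * fderiv ℝ f z 1 + h.im * fderiv ℝ f z I := by
    conv_lhs => rw [hh]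
    rw [map_add, map_smul, map_smul, real_smul, real_smul]
  have h2 : h = h.re + h.im * I := (re_add_im h).symm
  have h3 : conj h = h.re - h.im * I := by apply Complex.ext <;> simp
  simp only [h1, _root_.add_apply, _root_.smul_apply,
    ContinuousLinearMap.id_apply, smul_eq_mul, ContinuousLinearEquiv.coe_coe, conjCLE_apply, h3]
  linear_combination (fderiv ℝ f z I * h.im) * I_mul_I
    - (fderiv ℝ f z 1 - I * fderiv ℝ f z I) / 2 * h2

end HasWirtingerDerivAt

/-! ### The Schwarzian of a hyperbolic metric -/

lemma HasWirtingerDerivAt.unique {f : ℂ → ℂ} {a b c d z : ℂ} (h₁ : HasWirtingerDerivAt f a b z)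
    (h₂ : HasWirtingerDerivAt f c d z) : a = c ∧ b = d := by
  have h := HasFDerivAt.unique h₁ h₂
  have e1 := DFunLike.congr_fun h 1
  have e2 := DFunLike.congr_fun h I
  simp at e1 e2
  have e3 : (a - b - c + d) * I = 0 := by linear_combination e2
  have e4 : a - b - c + d = 0 := by simpa using e3
  constructor
  · linear_combination (e1 + e4) / 2
  · linear_combination (e1 - e4) / 2

/-- The Wirtinger derivative `∂f/∂z`. -/
noncomputable def wirtingerDz (f : ℂ → ℂ) (z : ℂ) : ℂ :=
  (fderiv ℝ f z 1 - I * fderiv ℝ f z I) / 2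

/-- The Wirtinger derivative `∂f/∂z̄`. -/
noncomputable def wirtingerDzbar (f : ℂ → ℂ) (z : ℂ) : ℂ :=
  (fderiv ℝ f z 1 + I * fderiv ℝ f z I) / 2

lemma fderiv_fderiv_apply {f : ℂ → ℂ} {z : ℂ} (hf : ContDiffAt ℝ 2 f z) (v : ℂ) :
    HasFDerivAt (fun w => fderiv ℝ f w v)
      ((fderiv ℝ (fderiv ℝ f) z).flip v) z := by
  have h1 : DifferentiableAt ℝ (fderiv ℝ f) z :=
    (hf.fderiv_right (m := 1) (by norm_num)).differentiableAt (by norm_num)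
  have := h1.hasFDerivAt.clm_apply (hasFDerivAt_const v z)
  refine this.congr_fderiv ?_
  ext h
  simp

lemma laplacian_eq_fderiv_fderiv (f : ℂ → ℂ) (z : ℂ) :
    Laplacian.laplacian f z =
      fderiv ℝ (fderiv ℝ f) z 1 1 + fderiv ℝ (fderiv ℝ f) z I I := by
  rw [InnerProductSpace.laplacian_eq_iteratedFDeriv_complexPlane]
  simp [iteratedFDeriv_two_apply]

lemma contDiffAt_wirtingerDz {f : ℂ → ℂ} {z : ℂ} (hf : ContDiffAt ℝ ∞ f z) :
    ContDiffAt ℝ ∞ (wirtingerDz f) z := by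
  have h := hf.fderiv_right (m := ∞) (by simp)
  unfold wirtingerDz
  exact ((h.clm_apply contDiffAt_const).sub
    (contDiffAt_const.mul (h.clm_apply contDiffAt_const))).div_const _

lemma hasWirtingerDerivAt_wirtingerDz {f : ℂ → ℂ} {z : ℂ} (hf : ContDiffAt ℝ 2 f z) :
    HasWirtingerDerivAt (wirtingerDz f) (wirtingerDz (wirtingerDz f) z)
      (Laplacian.laplacian f z / 4) z := by
  have hs := (hf.isSymmSndFDerivAt (by simp)) 1 I
  have hd : HasFDerivAt (wirtingerDz f) _ z :=
    ((fderiv_fderiv_apply hf 1).sub ((fderiv_fderiv_apply hf I).const_mul I)).mul_const (2⁻¹ : ℂ)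
  refine (HasWirtingerDerivAt.of_differentiableAt hd.differentiableAt).congr_deriv rfl ?_
  rw [hd.fderiv, laplacian_eq_fderiv_fderiv]
  simp
  rw [hs]
  linear_combination (-(fderiv ℝ (fderiv ℝ f) z I I) / 4) * I_mul_I

lemma hasWirtingerDerivAt_wirtingerDzbar {f : ℂ → ℂ} {z : ℂ} (hf : ContDiffAt ℝ 2 f z) :
    HasWirtingerDerivAt (wirtingerDzbar f) (Laplacian.laplacian f z / 4)
      (wirtingerDzbar (wirtingerDzbar f) z) z := by
  have hs := (hf.isSymmSndFDerivAt (by simp)) 1 I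
  have hd : HasFDerivAt (wirtingerDzbar f) _ z :=
    ((fderiv_fderiv_apply hf 1).add ((fderiv_fderiv_apply hf I).const_mul I)).mul_const (2⁻¹ : ℂ)
  refine (HasWirtingerDerivAt.of_differentiableAt hd.differentiableAt).congr_deriv ?_ rfl
  rw [hd.fderiv, laplacian_eq_fderiv_fderiv]
  simp
  rw [hs]
  linear_combination (-(fderiv ℝ (fderiv ℝ f) z I I) / 4) * I_mul_I

lemma isOpen_puncturedDisk : IsOpen puncturedDisk := isOpen_ball.sdiff isClosed_singleton

/-- For a metric `e^{2u} |dw|²` of curvature `-1`, put `g = ∂u/∂w`.  Liouville's equation says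
`∂g/∂w̄ = e^{2u} / 4`, and it makes the quantity `Q = ∂g/∂w - g²` holomorphic. -/
lemma IsConformalHyperbolicMetric.exists_schwarzian {ρ : ℂ → ℝ}
    (hρ : IsConformalHyperbolicMetric ρ puncturedDisk) :
    ∃ g Q : ℂ → ℂ, DifferentiableOn ℂ Q puncturedDisk ∧ ∀ w ∈ puncturedDisk,
      HasWirtingerDerivAt (fun x => ((Real.log (ρ x) / 2 : ℝ) : ℂ)) (g w) (conj (g w)) w ∧
      HasWirtingerDerivAt g (Q w + g w ^ 2) (ρ w / 4) w := by
  have two_le : (2 : WithTop ℕ∞) ≤ ∞ := WithTop.coe_le_coe.2 le_top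
  set L : ℂ → ℂ := fun x => ((Real.log (ρ x) / 2 : ℝ) : ℂ) with hL
  have hc : ∀ w ∈ puncturedDisk, ContDiffAt ℝ ∞ (fun x => Real.log (ρ x)) w := fun w hw =>
    (hρ.smooth.contDiffAt (isOpen_puncturedDisk.mem_nhds hw)).log (hρ.pos w hw).ne'
  have hLc : ∀ w ∈ puncturedDisk, ContDiffAt ℝ ∞ L w := fun w hw =>
    ofRealCLM.contDiff.contDiffAt.comp w ((hc w hw).div_const 2)
  have hlap : ∀ w ∈ puncturedDisk, Laplacian.laplacian L w = ρ w := by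
    intro w hw
    have h1 : L = (((1 / 2 : ℝ) • ofRealCLM : ℝ →L[ℝ] ℂ)) ∘ fun x => Real.log (ρ x) := by
      funext x
      simp [hL]
      ring
    have h2 := hρ.curvature w hw
    rw [gaussCurvature, div_eq_iff (by have := hρ.pos w hw; positivity)] at h2
    rw [h1, ((hc w hw).of_le two_le).laplacian_CLM_comp_left]
    have h3 : Laplacian.laplacian (fun x => Real.log (ρ x)) w = 2 * ρ w := by linarith
    simp [h3]
  have hdL : ∀ w ∈ puncturedDisk,
      HasWirtingerDerivAt L (wirtingerDz L w) (wirtingerDzbar L w) w := fun w hw =>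
    .of_differentiableAt ((hLc w hw).differentiableAt (by simp))
  have hconj : ∀ w ∈ puncturedDisk, wirtingerDzbar L w = conj (wirtingerDz L w) := by
    intro w hw
    refine ((hdL w hw).unique ((hdL w hw).conjugate.congr_fun ?_)).2
    exact Eventually.of_forall fun x => (conj_ofReal _).symm
  set g := wirtingerDz L with hg
  have hgc : ∀ w ∈ puncturedDisk, ContDiffAt ℝ ∞ g w := fun w hw =>
    contDiffAt_wirtingerDz (hLc w hw)
  have hdg : ∀ w ∈ puncturedDisk, HasWirtingerDerivAt g (wirtingerDz g w) (ρ w / 4) w := by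
    intro w hw
    have := hasWirtingerDerivAt_wirtingerDz ((hLc w hw).of_le two_le)
    rwa [hlap w hw] at this
  refine ⟨g, fun w => wirtingerDz g w - g w ^ 2, ?_, fun w hw => ⟨?_, ?_⟩⟩
  · intro w hw
    have e1 := hasWirtingerDerivAt_wirtingerDz ((hgc w hw).of_le two_le)
    have e2 := hasWirtingerDerivAt_wirtingerDzbar ((hgc w hw).of_le two_le)
    have e3 : HasWirtingerDerivAt (wirtingerDzbar g) (g w * ρ w / 2) (conj (g w) * ρ w / 2) w := by
      have e4 := ((hdL w hw).const_mul 2).comp_left (φ := Complex.exp) (hasDerivAt_exp _)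
      have e5 : ∀ x ∈ puncturedDisk, exp (2 * L x) = ρ x := by
        intro x hx
        rw [hL]
        push_cast
        rw [mul_div_cancel₀ _ (two_ne_zero), ← ofReal_exp, Real.exp_log (hρ.pos x hx)]
      rw [e5 w hw, hconj w hw] at e4
      refine ((e4.const_mul (1 / 4)).congr_fun ?_).congr_deriv (by ring) (by ring)
      filter_upwards [isOpen_puncturedDisk.mem_nhds hw] with x hx
      rw [e5 x hx]
      have := (HasWirtingerDerivAt.of_differentiableAt
        ((hgc x hx).differentiableAt (by simp))).unique (hdg x hx)
      rw [wirtingerDzbar, this.2]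
      ring
    have e6 : Laplacian.laplacian g w / 4 = g w * ρ w / 2 := (e2.unique e3).1
    have e7 := e1.sub ((hdg w hw).mul (hdg w hw))
    have e8 := (e7.congr_fun (g := fun w => wirtingerDz g w - g w ^ 2)
      (Eventually.of_forall fun x => by simp [pow_two])).congr_deriv rfl (d := 0)
      (by rw [e6]; ring)
    exact e8.hasDerivAt.differentiableAt.differentiableWithinAt
  · rw [← hconj w hw]
    exact hdL w hw
  · exact (hdg w hw).congr_deriv (by ring) rfl

/-! ### Linear equations of second order on the unit disk -/

/-- A power series whose coefficients are bounded along every radius `r < 1` can be differentiated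
termwise in the unit disk. -/
lemma hasDerivAt_powerSeries {c : ℕ → ℂ}
    (hc : ∀ r : ℝ, 0 < r → r < 1 → ∃ C, ∀ n, ‖c n‖ * r ^ n ≤ C) {x : ℂ} (hx : ‖x‖ < 1) :
    HasDerivAt (fun y => ∑' n, c n * y ^ n) (∑' n : ℕ, ((n + 1) * c (n + 1)) * x ^ n) x := by
  obtain ⟨s, hs1, hs2⟩ := exists_between hx
  obtain ⟨r, hr1, hr2⟩ := exists_between hs2
  have hs0 : 0 < s := (norm_nonneg x).trans_lt hs1
  have hr0 : 0 < r := hs0.trans hr1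
  obtain ⟨C, hC⟩ := hc r hr0 hr2
  have hq : s / r < 1 := (div_lt_one hr0).2 hr1
  have hsum : Summable fun n : ℕ => (C / s) * ((n : ℝ) * (s / r) ^ n) := by
    refine Summable.mul_left _ ?_
    have := summable_pow_mul_geometric_of_norm_lt_one 1 (r := s / r)
      (by rwa [Real.norm_of_nonneg (by positivity)])
    simpa using this
  have hb : ∀ (n : ℕ) (y : ℂ), y ∈ ball (0 : ℂ) s →
      ‖c n * (n * y ^ (n - 1))‖ ≤ (C / s) * ((n : ℝ) * (s / r) ^ n) := by
    intro n y hy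
    rcases n with _ | n
    · simp
    have h1 : ‖y‖ ^ n ≤ s ^ n := by
      gcongr
      simpa using (mem_ball_zero_iff.1 hy).le
    have h2 := hC (n + 1)
    have h3 : C / s * (((n + 1 : ℕ) : ℝ) * (s / r) ^ (n + 1)) = (n + 1) * (C / r ^ (n + 1) * s ^ n) := by
      rw [div_pow]
      field_simp
      push_cast
      ring
    have h4 : ‖c (n + 1)‖ ≤ C / r ^ (n + 1) := (le_div_iff₀ (by positivity)).2 h2
    rw [h3, norm_mul, norm_mul, norm_pow, norm_natCast, Nat.add_sub_cancel]
    push_cast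
    calc ‖c (n + 1)‖ * ((n + 1) * ‖y‖ ^ n) = (n + 1) * (‖c (n + 1)‖ * ‖y‖ ^ n) := by ring
      _ ≤ _ := by
        have : 0 ≤ C / r ^ (n + 1) := (norm_nonneg _).trans h4
        gcongr
  have hx' : x ∈ ball (0 : ℂ) s := by simpa using hs1
  have key := hasDerivAt_tsum_of_isPreconnected (𝕜 := ℂ) (F := ℂ)
    (g := fun n y => c n * y ^ n) (g' := fun n y => c n * (n * y ^ (n - 1)))
    (t := ball (0 : ℂ) s) (y₀ := 0) (y := x) hsum
    isOpen_ball (convex_ball _ _).isPreconnected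
    (fun n y _ => (hasDerivAt_pow n y).const_mul _) hb (mem_ball_self hs0) ?_ hx'
  · have e : ∑' n : ℕ, c n * (n * x ^ (n - 1)) = ∑' n : ℕ, ((n + 1) * c (n + 1)) * x ^ n := by
      rw [(Summable.of_norm_bounded hsum fun n => hb n x hx').tsum_eq_zero_add]
      simp only [Nat.cast_zero, zero_mul, mul_zero, zero_add, Nat.cast_add, Nat.cast_one,
        Nat.add_sub_cancel]
      exact tsum_congr fun n => by ring
    rw [← e]
    exact key
  · refine summable_of_ne_finset_zero (s := {0}) fun n hn => ?_
    simp at hn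
    simp [hn]

/-- Boundedness along every radius `r < 1` is inherited by the derived series. -/
lemma bounded_derived_coeff {c : ℕ → ℂ}
    (hc : ∀ r : ℝ, 0 < r → r < 1 → ∃ C, ∀ n, ‖c n‖ * r ^ n ≤ C) (r : ℝ) (hr0 : 0 < r)
    (hr1 : r < 1) : ∃ C, ∀ n : ℕ, ‖((n + 1) * c (n + 1) : ℂ)‖ * r ^ n ≤ C := by
  obtain ⟨R, hR1, hR2⟩ := exists_between hr1
  have hR0 : 0 < R := hr0.trans hR1
  obtain ⟨C, hC⟩ := hc R hR0 hR2
  have hq : r / R < 1 := (div_lt_one hR0).2 hR1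
  have ht := tendsto_self_mul_const_pow_of_lt_one (r := r / R) (by positivity) hq
  obtain ⟨D, hD⟩ := ht.bddAbove_range
  have hC0 : 0 ≤ C := le_trans (by positivity) (hC 0)
  refine ⟨D * C / r, fun n => ?_⟩
  have h1 := hD ⟨n + 1, rfl⟩
  simp only [div_pow] at h1
  have h2 := hC (n + 1)
  have h4 : ‖c (n + 1)‖ ≤ C / R ^ (n + 1) := (le_div_iff₀ (by positivity)).2 h2
  have h5 : ‖((n : ℂ) + 1)‖ = n + 1 := by
    rw [← Nat.cast_succ, norm_natCast]
    simp
  rw [norm_mul, h5, le_div_iff₀ hr0]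
  push_cast at h1
  calc (n + 1) * ‖c (n + 1)‖ * r ^ n * r ≤ (n + 1) * (C / R ^ (n + 1)) * r ^ n * r := by gcongr
    _ = ((n + 1) * (r ^ (n + 1) / R ^ (n + 1))) * C := by ring
    _ ≤ D * C := by gcongr

/-- The Taylor coefficients at `0` of the solution of `y'' = (∑ qₙ xⁿ) y` with `y(0) = A` and
`y'(0) = B`. -/
noncomputable def odeCoeff (q : ℕ → ℂ) (A B : ℂ) : ℕ → ℂ
  | 0 => A
  | 1 => B
  | n + 2 => (∑ k : Fin (n + 1), q (n - k) * odeCoeff q A B k) / ((n + 2) * (n + 1))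
decreasing_by omega

lemma odeCoeff_add_two (q : ℕ → ℂ) (A B : ℂ) (n : ℕ) :
    odeCoeff q A B (n + 2) =
      (∑ k ∈ Finset.range (n + 1), q (n - k) * odeCoeff q A B k) / ((n + 2) * (n + 1)) := by
  rw [odeCoeff, Fin.sum_univ_eq_sum_range (fun k => q (n - k) * odeCoeff q A B k)]

lemma odeCoeff_bounded {q : ℕ → ℂ}
    (hq : ∀ r : ℝ, 0 < r → r < 1 → ∃ C, ∀ n, ‖q n‖ * r ^ n ≤ C) (A B : ℂ) (r : ℝ) (hr0 : 0 < r)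
    (hr1 : r < 1) : ∃ C, ∀ n : ℕ, ‖odeCoeff q A B n‖ * r ^ n ≤ C := by
  obtain ⟨R, hR1, hR2⟩ := exists_between hr1
  have hR0 : 0 < R := hr0.trans hR1
  obtain ⟨M, hM⟩ := hq R hR0 hR2
  have hM0 : 0 ≤ M := le_trans (by positivity) (hM 0)
  have hrR : r / R < 1 := (div_lt_one hR0).2 hR1
  have hrR0 : 0 ≤ r / R := by positivity
  set c := odeCoeff q A B with hc
  set K := M / (1 - r / R) with hK
  have hgeom : ∀ n, ∑ k ∈ Finset.range (n + 1), ‖q (n - k)‖ * r ^ (n - k) ≤ K := by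
    intro n
    have hrefl := Finset.sum_range_reflect (fun k => ‖q k‖ * r ^ k) (n + 1)
    simp only [Nat.add_sub_cancel] at hrefl
    rw [hrefl]
    calc ∑ k ∈ Finset.range (n + 1), ‖q k‖ * r ^ k
        ≤ ∑ k ∈ Finset.range (n + 1), M * (r / R) ^ k := by
          refine Finset.sum_le_sum fun k _ => ?_
          have := hM k
          have h4 : ‖q k‖ ≤ M / R ^ k := (le_div_iff₀ (by positivity)).2 this
          calc ‖q k‖ * r ^ k ≤ M / R ^ k * r ^ k := by gcongr
            _ = M * (r / R) ^ k := by rw [div_pow]; ring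
      _ = M * ∑ k ∈ Finset.range (n + 1), (r / R) ^ k := by rw [Finset.mul_sum]
      _ ≤ M * (1 - r / R)⁻¹ := by
          gcongr
          have := Summable.sum_le_tsum (Finset.range (n + 1)) (fun k _ => pow_nonneg hrR0 k)
            (summable_geometric_of_lt_one hrR0 hrR)
          rwa [tsum_geometric_of_lt_one hrR0 hrR] at this
      _ = K := (div_eq_mul_inv M _).symm
  obtain ⟨N, hN⟩ := exists_nat_ge K
  set C := ∑ k ∈ Finset.range (N + 2), ‖c k‖ * r ^ k with hC
  have hC0 : 0 ≤ C := Finset.sum_nonneg fun k _ => by positivity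
  refine ⟨C, fun n => ?_⟩
  induction n using Nat.strong_induction_on with
  | _ n ih =>
    by_cases hn : n < N + 2
    · exact Finset.single_le_sum (f := fun k => ‖c k‖ * r ^ k) (fun k _ => by positivity)
        (Finset.mem_range.2 hn)
    obtain ⟨m, rfl⟩ : ∃ m, n = m + 2 := ⟨n - 2, by omega⟩
    have hNm : (N : ℝ) ≤ m := by exact_mod_cast (by omega : N ≤ m)
    have hden : ‖(((m : ℂ) + 2) * (m + 1))‖ = ((m : ℝ) + 2) * (m + 1) := by
      rw [show ((m : ℂ) + 2) * (m + 1) = (((m + 2) * (m + 1) : ℕ) : ℂ) by push_cast; ring,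
        Complex.norm_natCast]
      push_cast
      ring
    have hsum : ‖∑ k ∈ Finset.range (m + 1), q (m - k) * c k‖ * r ^ m ≤ K * C := by
      calc ‖∑ k ∈ Finset.range (m + 1), q (m - k) * c k‖ * r ^ m
          ≤ (∑ k ∈ Finset.range (m + 1), ‖q (m - k) * c k‖) * r ^ m := by
            gcongr
            exact norm_sum_le _ _
        _ = ∑ k ∈ Finset.range (m + 1), (‖q (m - k)‖ * r ^ (m - k)) * (‖c k‖ * r ^ k) := by
            rw [Finset.sum_mul]
            refine Finset.sum_congr rfl fun k hk => ?_
            have : m = (m - k) + k := by have := Finset.mem_range.1 hk; omega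
            rw [norm_mul]
            conv_lhs => rw [show r ^ m = r ^ (m - k) * r ^ k by rw [← pow_add, ← this]]
            ring
        _ ≤ ∑ k ∈ Finset.range (m + 1), (‖q (m - k)‖ * r ^ (m - k)) * C := by
            refine Finset.sum_le_sum fun k hk => ?_
            have := ih k (by have := Finset.mem_range.1 hk; omega)
            gcongr
        _ = (∑ k ∈ Finset.range (m + 1), ‖q (m - k)‖ * r ^ (m - k)) * C := by
            rw [Finset.sum_mul]
        _ ≤ K * C := by
            gcongr
            exact hgeom m
    rw [hc, odeCoeff_add_two, ← hc, norm_div, hden, pow_add, div_mul_eq_mul_div,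
      div_le_iff₀ (by positivity)]
    have hr2 : r ^ 2 ≤ 1 := by nlinarith
    calc ‖∑ k ∈ Finset.range (m + 1), q (m - k) * c k‖ * (r ^ m * r ^ 2)
        = ‖∑ k ∈ Finset.range (m + 1), q (m - k) * c k‖ * r ^ m * r ^ 2 := by ring
      _ ≤ ‖∑ k ∈ Finset.range (m + 1), q (m - k) * c k‖ * r ^ m * 1 := by gcongr
      _ ≤ K * C := by simpa using hsum
      _ ≤ ((m + 2) * (m + 1)) * C := by
          gcongr
          have : (0 : ℝ) ≤ m := by positivity
          nlinarith
      _ = _ := by ring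

/-- The linear equation `y'' = Q y` with `Q` holomorphic on the unit disk has a solution on the whole
disk, with arbitrary values of `y` and `y'` at the centre. -/
lemma exists_solution_ball {Q : ℂ → ℂ} (hQ : DifferentiableOn ℂ Q (ball 0 1)) (A B : ℂ) :
    ∃ y y' : ℂ → ℂ, y 0 = A ∧ y' 0 = B ∧ ∀ x ∈ ball (0 : ℂ) 1,
      HasDerivAt y (y' x) x ∧ HasDerivAt y' (Q x * y x) x := by
  set q : ℕ → ℂ := fun n => (n.factorial : ℂ)⁻¹ * iteratedDeriv n Q 0 with hqdef
  have hQs : ∀ x ∈ ball (0 : ℂ) 1, HasSum (fun n => q n * x ^ n) (Q x) := by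
    intro x hx
    have := Complex.hasSum_taylorSeries_on_ball hQ hx
    convert! this using 2 with n
    simp only [hqdef, smul_eq_mul, sub_zero]
    ring
  have hq : ∀ r : ℝ, 0 < r → r < 1 → ∃ C, ∀ n, ‖q n‖ * r ^ n ≤ C := by
    intro r hr0 hr1
    have h1 := (hQs r (by simpa [abs_of_pos hr0] using hr1)).summable.tendsto_atTop_zero.norm
    obtain ⟨C, hC⟩ := h1.bddAbove_range
    exact ⟨C, fun n => by simpa [abs_of_pos hr0] using hC ⟨n, rfl⟩⟩
  set c := odeCoeff q A B with hc
  have hcb := odeCoeff_bounded hq A B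
  have hcb' := bounded_derived_coeff hcb
  refine ⟨fun x => ∑' n, c n * x ^ n, fun x => ∑' n : ℕ, ((n + 1) * c (n + 1)) * x ^ n, ?_, ?_, ?_⟩
  · beta_reduce
    rw [tsum_eq_single 0 (fun n hn => by simp [hn])]
    simp [hc, odeCoeff]
  · beta_reduce
    rw [tsum_eq_single 0 (fun n hn => by simp [hn])]
    simp [hc, odeCoeff]
  intro x hx
  have hx1 : ‖x‖ < 1 := by simpa using hx
  refine ⟨hasDerivAt_powerSeries hcb hx1, ?_⟩
  refine (hasDerivAt_powerSeries hcb' hx1).congr_deriv ?_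
  have habs : ∀ a : ℕ → ℂ, (∀ r : ℝ, 0 < r → r < 1 → ∃ C, ∀ n, ‖a n‖ * r ^ n ≤ C) →
      Summable fun n => ‖a n * x ^ n‖ := by
    intro a ha
    obtain ⟨r, hr1, hr2⟩ := exists_between hx1
    have hr0 : 0 < r := (norm_nonneg x).trans_lt hr1
    obtain ⟨C, hC⟩ := ha r hr0 hr2
    refine Summable.of_nonneg_of_le (fun n => norm_nonneg _) (fun n => ?_)
      ((summable_geometric_of_lt_one (r := ‖x‖ / r) (by positivity)
        ((div_lt_one hr0).2 hr1)).mul_left C)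
    rw [norm_mul, norm_pow, div_pow, mul_div_assoc', le_div_iff₀ (by positivity)]
    calc ‖a n‖ * ‖x‖ ^ n * r ^ n = ‖a n‖ * r ^ n * ‖x‖ ^ n := by ring
      _ ≤ C * ‖x‖ ^ n := by
        gcongr
        exact hC n
  rw [← (hQs x hx).tsum_eq]
  rw [tsum_mul_tsum_eq_tsum_sum_range_of_summable_norm (habs q hq) (habs c hcb)]
  refine tsum_congr fun n => ?_
  have e : ((n : ℂ) + 2) * (n + 1) ≠ 0 := by
    norm_cast
  have := odeCoeff_add_two q A B n
  rw [eq_div_iff e, ← hc] at this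
  rw [← Finset.sum_range_reflect]
  push_cast
  calc _ = (c (n + 2) * ((n + 2) * (n + 1))) * x ^ n := by ring
    _ = _ := by
      rw [this, Finset.sum_mul]
      refine Finset.sum_congr rfl fun k hk => ?_
      have hk' : k ≤ n := by have := Finset.mem_range.1 hk; omega
      rw [show n - (n - k) = k by omega]
      conv_lhs => rw [show x ^ n = x ^ (n - k) * x ^ k by rw [← pow_add, Nat.sub_add_cancel hk']]
      ring

/-! ### The Liouville system on the left half-plane -/

/-- The left half-plane `Re ζ < 0`, the universal cover of the punctured unit disk by `exp`. -/
def leftHalfPlane : Set ℂ := {ζ | ζ.re < 0}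

lemma isOpen_leftHalfPlane : IsOpen leftHalfPlane := isOpen_lt continuous_re continuous_const

lemma convex_leftHalfPlane : Convex ℝ leftHalfPlane := convex_halfSpace_re_lt 0

lemma neg_one_mem_leftHalfPlane : (-1 : ℂ) ∈ leftHalfPlane := by simp [leftHalfPlane]

lemma exp_mem_puncturedDisk {ζ : ℂ} (h : ζ ∈ leftHalfPlane) : exp ζ ∈ puncturedDisk := by
  refine ⟨?_, by simp⟩
  rw [mem_ball_zero_iff, norm_exp]
  rw [← Real.exp_zero]
  exact Real.exp_lt_exp.2 h

lemma add_two_pi_I_mem {ζ : ℂ} (h : ζ ∈ leftHalfPlane) :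
    ζ + 2 * Real.pi * I ∈ leftHalfPlane := by
  simpa [leftHalfPlane] using h

lemma exp_add_two_pi_I (ζ : ℂ) : exp (ζ + 2 * Real.pi * I) = exp ζ := exp_periodic ζ

/-- `y` solves `y'' + Q y = 0` on the left half-plane, with derivative `y'`. -/
def SolvesODE (Q y y' : ℂ → ℂ) : Prop :=
  ∀ ζ ∈ leftHalfPlane, HasDerivAt y (y' ζ) ζ ∧ HasDerivAt y' (-(Q ζ * y ζ)) ζ

/-- The Cayley transform `C ζ = (ζ + 1) / (ζ - 1)` turns `g'' = -4 Q(C s) (s - 1)⁻⁴ g` on the unit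
disk into `y'' + Q y = 0` on the half-plane, by `y ζ = (ζ - 1) g(C ζ)`; the factor `ζ - 1` is
`(C')^{-1/2}` up to a constant. -/
lemma exists_solvesODE {Q : ℂ → ℂ} (hQ : DifferentiableOn ℂ Q leftHalfPlane) (A B : ℂ) :
    ∃ y y' : ℂ → ℂ, y (-1) = A ∧ y' (-1) = B ∧ SolvesODE Q y y' := by
  have hball : ∀ s ∈ ball (0 : ℂ) 1, s - 1 ≠ 0 ∧ (s + 1) / (s - 1) ∈ leftHalfPlane := by
    intro s hs
    have h1 : ‖s‖ < 1 := by simpa using hs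
    have h0 : s - 1 ≠ 0 := by
      rintro h
      rw [sub_eq_zero.1 h] at h1
      simp at h1
    refine ⟨h0, ?_⟩
    have h2 : normSq s < 1 := by
      rw [normSq_eq_norm_sq]
      nlinarith [norm_nonneg s]
    have h3 : 0 < normSq (s - 1) := normSq_pos.2 h0
    have : ((s + 1) / (s - 1)).re = (normSq s - 1) / normSq (s - 1) := by
      rw [div_re, normSq_apply s]
      simp
      ring
    simp only [leftHalfPlane, mem_ofPred_eq, this]
    exact div_neg_of_neg_of_pos (by linarith) h3
  have hhalf : ∀ ζ ∈ leftHalfPlane, ζ - 1 ≠ 0 ∧ (ζ + 1) / (ζ - 1) ∈ ball (0 : ℂ) 1 := by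
    intro ζ hζ
    have h1 : ζ.re < 0 := hζ
    have h0 : ζ - 1 ≠ 0 := by
      intro h
      rw [sub_eq_zero.1 h] at h1
      simp at h1
      linarith
    refine ⟨h0, ?_⟩
    rw [mem_ball_zero_iff, norm_div, div_lt_one (norm_pos_iff.2 h0)]
    refine lt_of_pow_lt_pow_left₀ 2 (norm_nonneg _) ?_
    rw [← normSq_eq_norm_sq, ← normSq_eq_norm_sq, normSq_apply, normSq_apply]
    simp
    nlinarith
  obtain ⟨g, g', hg0, hg'0, hg⟩ := exists_solution_ball
    (Q := fun s => -4 * Q ((s + 1) / (s - 1)) / (s - 1) ^ 4) (by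
      intro s hs
      obtain ⟨h0, h1⟩ := hball s hs
      have h2 : DifferentiableAt ℂ Q ((s + 1) / (s - 1)) :=
        hQ.differentiableAt (isOpen_leftHalfPlane.mem_nhds h1)
      have h3 : DifferentiableAt ℂ (fun s : ℂ => (s + 1) / (s - 1)) s := by
        fun_prop (disch := exact h0)
      have h4 : DifferentiableAt ℂ (fun s : ℂ => Q ((s + 1) / (s - 1))) s :=
        DifferentiableAt.comp s h2 h3
      exact ((h4.const_mul _).div (by fun_prop : DifferentiableAt ℂ (fun s : ℂ => (s - 1) ^ 4) s)
        (pow_ne_zero 4 h0)).differentiableWithinAt)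
    (-A / 2) (B + A / 2)
  refine ⟨fun ζ => (ζ - 1) * g ((ζ + 1) / (ζ - 1)),
    fun ζ => g ((ζ + 1) / (ζ - 1)) - 2 * g' ((ζ + 1) / (ζ - 1)) / (ζ - 1), ?_, ?_, ?_⟩
  · simp [hg0]
    ring
  · simp [hg0, hg'0]
    ring
  intro ζ hζ
  obtain ⟨h0, h1⟩ := hhalf ζ hζ
  obtain ⟨e1, e2⟩ := hg _ h1
  have hC : HasDerivAt (fun ζ : ℂ => (ζ + 1) / (ζ - 1)) (-2 / (ζ - 1) ^ 2) ζ := by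
    refine (((hasDerivAt_id ζ).add_const 1).div ((hasDerivAt_id ζ).sub_const 1) h0).congr_deriv ?_
    simp only [id]
    ring
  have hinv : ((ζ + 1) / (ζ - 1) + 1) / ((ζ + 1) / (ζ - 1) - 1) = ζ := by
    have e : (ζ + 1) / (ζ - 1) - 1 = 2 / (ζ - 1) := by field_simp; ring
    rw [e]
    field_simp
    ring
  have hone : (ζ + 1) / (ζ - 1) - 1 = 2 / (ζ - 1) := by field_simp; ring
  rw [hinv, hone] at e2
  have d1 := HasDerivAt.comp ζ e1 hC
  have d2 := HasDerivAt.comp ζ e2 hC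
  have d0 : HasDerivAt (fun ζ : ℂ => ζ - 1) 1 ζ := (hasDerivAt_id ζ).sub_const 1
  constructor
  · refine (d0.mul d1).congr_deriv ?_
    simp only [Function.comp]
    field_simp
    ring
  · refine (d1.sub ((d2.const_mul 2).div d0 h0)).congr_deriv ?_
    simp only [Function.comp]
    field_simp
    ring

lemma SolvesODE.wronskian_eq {Q y y' z z' : ℂ → ℂ} (hy : SolvesODE Q y y')
    (hz : SolvesODE Q z z') {ζ ξ : ℂ} (hζ : ζ ∈ leftHalfPlane) (hξ : ξ ∈ leftHalfPlane) :
    y ζ * z' ζ - y' ζ * z ζ = y ξ * z' ξ - y' ξ * z ξ := by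
  refine HasWirtingerDerivAt.eq_on_convex (f := fun ζ => y ζ * z' ζ - y' ζ * z ζ)
    isOpen_leftHalfPlane convex_leftHalfPlane (fun w hw => ?_) hζ hξ
  obtain ⟨a, b⟩ := hy w hw
  obtain ⟨c, d⟩ := hz w hw
  exact HasWirtingerDerivAt.of_hasDerivAt (((a.mul d).sub (b.mul c)).congr_deriv (by ring))

lemma SolvesODE.eq_combination {Q y₁ y₁' y₂ y₂' y y' : ℂ → ℂ} (h₁ : SolvesODE Q y₁ y₁')
    (h₂ : SolvesODE Q y₂ y₂') (h : SolvesODE Q y y')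
    (hw : ∀ ζ ∈ leftHalfPlane, y₁ ζ * y₂' ζ - y₁' ζ * y₂ ζ = 1) :
    ∃ a b : ℂ, ∀ ζ ∈ leftHalfPlane,
      y ζ = a * y₁ ζ + b * y₂ ζ ∧ y' ζ = a * y₁' ζ + b * y₂' ζ := by
  refine ⟨y (-1) * y₂' (-1) - y' (-1) * y₂ (-1), y₁ (-1) * y' (-1) - y₁' (-1) * y (-1),
    fun ζ hζ => ?_⟩
  rw [← h.wronskian_eq h₂ hζ neg_one_mem_leftHalfPlane,
    ← h₁.wronskian_eq h hζ neg_one_mem_leftHalfPlane]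
  have := hw ζ hζ
  constructor
  · linear_combination (-y ζ) * this
  · linear_combination (-y' ζ) * this

lemma SolvesODE.translate {Q y y' : ℂ → ℂ} (h : SolvesODE Q y y')
    (hQ : ∀ ζ, Q (ζ + 2 * Real.pi * I) = Q ζ) :
    SolvesODE Q (fun ζ => y (ζ + 2 * Real.pi * I)) (fun ζ => y' (ζ + 2 * Real.pi * I)) := by
  intro ζ hζ
  obtain ⟨a, b⟩ := h _ (add_two_pi_I_mem hζ)
  rw [hQ] at b
  exact ⟨a.comp_add_const _ _, b.comp_add_const _ _⟩

/-- The system satisfied by `v = e^{-u}`, `p = ∂v/∂ζ` and `q = ∂²v/∂ζ∂ζ̄` when `e^{2u} |dζ|²` has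
curvature `-1`: `∂²v/∂ζ² = -Q v` with `Q` holomorphic. -/
structure LiouvilleSystem (Q v p q : ℂ → ℂ) : Prop where
  dv : ∀ ζ ∈ leftHalfPlane, HasWirtingerDerivAt v (p ζ) (conj (p ζ)) ζ
  dp : ∀ ζ ∈ leftHalfPlane, HasWirtingerDerivAt p (-(Q ζ * v ζ)) (q ζ) ζ
  dq : ∀ ζ ∈ leftHalfPlane,
    HasWirtingerDerivAt q (-(Q ζ * conj (p ζ))) (-(conj (Q ζ) * p ζ)) ζ
  conj_v : ∀ ζ, conj (v ζ) = v ζ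
  conj_q : ∀ ζ, conj (q ζ) = q ζ

/-- The sesquilinear expression in the `1`-jets `(Y, Y')`, `(Z, Z')` with coefficients `v, p, q`.
On solutions of `y'' + Q y = 0` it is constant. -/
noncomputable def liouvilleForm (v p q Y Y' Z Z' : ℂ) : ℂ :=
  v * Y' * conj Z' - p * Y * conj Z' - conj p * Y' * conj Z + q * Y * conj Z

lemma LiouvilleSystem.form_eq {Q v p q y y' z z' : ℂ → ℂ} (h : LiouvilleSystem Q v p q)
    (hy : SolvesODE Q y y') (hz : SolvesODE Q z z') {ζ ξ : ℂ} (hζ : ζ ∈ leftHalfPlane)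
    (hξ : ξ ∈ leftHalfPlane) :
    liouvilleForm (v ζ) (p ζ) (q ζ) (y ζ) (y' ζ) (z ζ) (z' ζ) =
      liouvilleForm (v ξ) (p ξ) (q ξ) (y ξ) (y' ξ) (z ξ) (z' ξ) := by
  refine HasWirtingerDerivAt.eq_on_convex
    (f := fun ζ => liouvilleForm (v ζ) (p ζ) (q ζ) (y ζ) (y' ζ) (z ζ) (z' ζ))
    isOpen_leftHalfPlane convex_leftHalfPlane (fun w hw => ?_) hζ hξ
  have dy := HasWirtingerDerivAt.of_hasDerivAt (hy w hw).1
  have dy' := HasWirtingerDerivAt.of_hasDerivAt (hy w hw).2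
  have dz := (HasWirtingerDerivAt.of_hasDerivAt (hz w hw).1).conjugate
  have dz' := (HasWirtingerDerivAt.of_hasDerivAt (hz w hw).2).conjugate
  have dv := h.dv w hw
  have dp := h.dp w hw
  have dpc := dp.conjugate
  have dq := h.dq w hw
  refine (((((dv.mul dy').mul dz').sub ((dp.mul dy).mul dz')).sub ((dpc.mul dy').mul dz)).add
    ((dq.mul dy).mul dz)).congr_deriv ?_ ?_
  · simp only [map_zero, h.conj_q]
    ring
  · simp only [map_neg, map_mul, h.conj_v]
    ring

/-- The two solutions of `y'' + Q y = 0` adapted to a Liouville system, in which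
`2 v = |y₁|² - |y₂|²`. -/
lemma LiouvilleSystem.exists_solutions {Q v p q : ℂ → ℂ} (h : LiouvilleSystem Q v p q)
    (hQ : DifferentiableOn ℂ Q leftHalfPlane)
    (hv : 0 < (v (-1)).re) (hvq : v (-1) * q (-1) = p (-1) * conj (p (-1)) - 1 / 4) :
    ∃ y₁ y₁' y₂ y₂' : ℂ → ℂ, SolvesODE Q y₁ y₁' ∧ SolvesODE Q y₂ y₂' ∧
      ∀ ζ ∈ leftHalfPlane, y₁ ζ * y₂' ζ - y₁' ζ * y₂ ζ = 1 ∧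
        2 * v ζ = y₁ ζ * conj (y₁ ζ) - y₂ ζ * conj (y₂ ζ) ∧
        liouvilleForm (v ζ) (p ζ) (q ζ) (y₁ ζ) (y₁' ζ) (y₁ ζ) (y₁' ζ) = -1 / 2 ∧
        liouvilleForm (v ζ) (p ζ) (q ζ) (y₁ ζ) (y₁' ζ) (y₂ ζ) (y₂' ζ) = 0 ∧
        liouvilleForm (v ζ) (p ζ) (q ζ) (y₂ ζ) (y₂' ζ) (y₂ ζ) (y₂' ζ) = 1 / 2 := by
  set a : ℝ := Real.sqrt (2 * (v (-1)).re) with ha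
  have ha0 : (a : ℂ) ≠ 0 := by
    rw [ofReal_ne_zero]
    exact (Real.sqrt_pos.2 (by linarith)).ne'
  have hvre : ((v (-1)).re : ℂ) = v (-1) := conj_eq_iff_re.1 (h.conj_v (-1))
  have ha2 : (a : ℂ) * a = 2 * v (-1) := by
    rw [← ofReal_mul, ha, Real.mul_self_sqrt (by linarith)]
    push_cast
    rw [hvre]
  have hinv : (a : ℂ) * (a : ℂ)⁻¹ = 1 := mul_inv_cancel₀ ha0
  -- `2 v = a²` at the base point, where `y₂` is made to vanish; the other initial values are then
  -- forced by the Wronskian and by `∂v/∂ζ = p`.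
  obtain ⟨y₁, y₁', b1, b1', s1⟩ := exists_solvesODE hQ a (2 * p (-1) * (a : ℂ)⁻¹)
  obtain ⟨y₂, y₂', b2, b2', s2⟩ := exists_solvesODE hQ 0 (a : ℂ)⁻¹
  have hai : v (-1) * ((a : ℂ)⁻¹ * (a : ℂ)⁻¹) = 1 / 2 := by
    linear_combination (-(a : ℂ)⁻¹ * (a : ℂ)⁻¹ / 2) * ha2 + (a * (a : ℂ)⁻¹ + 1) / 2 * hinv
  have hW : ∀ ζ ∈ leftHalfPlane, y₁ ζ * y₂' ζ - y₁' ζ * y₂ ζ = 1 := by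
    intro ζ hζ
    rw [s1.wronskian_eq s2 hζ neg_one_mem_leftHalfPlane, b1, b1', b2, b2']
    linear_combination hinv
  have f11 : ∀ ζ ∈ leftHalfPlane,
      liouvilleForm (v ζ) (p ζ) (q ζ) (y₁ ζ) (y₁' ζ) (y₁ ζ) (y₁' ζ) = -1 / 2 := by
    intro ζ hζ
    rw [h.form_eq s1 s1 hζ neg_one_mem_leftHalfPlane, b1, b1', liouvilleForm]
    simp only [map_mul, map_inv₀, conj_ofReal, map_ofNat]
    linear_combination (4 * p (-1) * conj (p (-1))) * hai
      - (4 * p (-1) * conj (p (-1))) * hinv + q (-1) * ha2 + 2 * hvq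
  have f12 : ∀ ζ ∈ leftHalfPlane,
      liouvilleForm (v ζ) (p ζ) (q ζ) (y₁ ζ) (y₁' ζ) (y₂ ζ) (y₂' ζ) = 0 := by
    intro ζ hζ
    rw [h.form_eq s1 s2 hζ neg_one_mem_leftHalfPlane, b1, b1', b2, b2', liouvilleForm]
    simp only [map_inv₀, conj_ofReal, map_zero]
    linear_combination (2 * p (-1)) * hai - p (-1) * hinv
  have f22 : ∀ ζ ∈ leftHalfPlane,
      liouvilleForm (v ζ) (p ζ) (q ζ) (y₂ ζ) (y₂' ζ) (y₂ ζ) (y₂' ζ) = 1 / 2 := by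
    intro ζ hζ
    rw [h.form_eq s2 s2 hζ neg_one_mem_leftHalfPlane, b2, b2', liouvilleForm]
    simp only [map_inv₀, conj_ofReal, map_zero]
    linear_combination hai
  refine ⟨y₁, y₁', y₂, y₂', s1, s2, fun ζ hζ => ⟨hW ζ hζ, ?_, f11 ζ hζ, f12 ζ hζ, f22 ζ hζ⟩⟩
  -- The solution `y₂(ζ) y₁ - y₁(ζ) y₂` has the jet `(0, -1)` at `ζ`, where the form takes the
  -- value `v` on it.
  have e11 := f11 ζ hζ
  have e12 := f12 ζ hζ
  have e22 := f22 ζ hζ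
  have e21 : conj (liouvilleForm (v ζ) (p ζ) (q ζ) (y₁ ζ) (y₁' ζ) (y₂ ζ) (y₂' ζ)) = 0 := by
    rw [e12, map_zero]
  have w := hW ζ hζ
  have wc : conj (y₁ ζ * y₂' ζ - y₁' ζ * y₂ ζ) = 1 := by rw [w, map_one]
  simp only [liouvilleForm, map_sub, map_mul, map_add, conj_conj, h.conj_v, h.conj_q] at *
  linear_combination (2 * y₂ ζ * conj (y₂ ζ)) * e11 - (2 * y₂ ζ * conj (y₁ ζ)) * e12
    - (2 * y₁ ζ * conj (y₂ ζ)) * e21 + (2 * y₁ ζ * conj (y₁ ζ)) * e22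
    - 2 * v ζ * (conj (y₁ ζ) * conj (y₂' ζ) - conj (y₁' ζ) * conj (y₂ ζ)) * w - 2 * v ζ * wc

/-! ### The developing pair and its monodromy -/

/-- The exponential substitution `v = e^{-u}` linearises Liouville's equation. -/
lemma liouvilleSystem_of_metric {u g Q E : ℂ → ℂ} (hu : ∀ ζ, conj (u ζ) = u ζ)
    (hE : ∀ ζ ∈ leftHalfPlane, E ζ = exp (2 * u ζ)) (hEc : ∀ ζ, conj (E ζ) = E ζ)
    (hdu : ∀ ζ ∈ leftHalfPlane, HasWirtingerDerivAt u (g ζ) (conj (g ζ)) ζ)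
    (hdg : ∀ ζ ∈ leftHalfPlane, HasWirtingerDerivAt g (Q ζ + g ζ ^ 2) (E ζ / 4) ζ) :
    LiouvilleSystem Q (fun ζ => exp (-u ζ)) (fun ζ => -(g ζ * exp (-u ζ)))
      (fun ζ => (g ζ * conj (g ζ) - E ζ / 4) * exp (-u ζ)) := by
  have hv : ∀ ζ ∈ leftHalfPlane, HasWirtingerDerivAt (fun ζ => exp (-u ζ))
      (-(g ζ * exp (-u ζ))) (-(conj (g ζ) * exp (-u ζ))) ζ := fun ζ hζ =>
    ((hdu ζ hζ).neg.comp_left (φ := exp) (hasDerivAt_exp _)).congr_deriv (by ring) (by ring)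
  have hvc : ∀ ζ, conj (exp (-u ζ)) = exp (-u ζ) := fun ζ => by
    rw [← exp_conj, map_neg, hu]
  constructor
  · intro ζ hζ
    refine (hv ζ hζ).congr_deriv rfl ?_
    simp only [map_neg, map_mul, hvc]
  · intro ζ hζ
    exact ((hdg ζ hζ).mul (hv ζ hζ)).neg.congr_deriv (by ring) (by ring)
  · intro ζ hζ
    have dE : HasWirtingerDerivAt E (2 * g ζ * E ζ) (2 * conj (g ζ) * E ζ) ζ := by
      refine (((hdu ζ hζ).const_mul 2).comp_left (φ := exp) (hasDerivAt_exp _)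
        |>.congr_fun ?_).congr_deriv ?_ ?_
      · filter_upwards [isOpen_leftHalfPlane.mem_nhds hζ] with ξ hξ using hE ξ hξ
      · rw [hE ζ hζ]
        ring
      · rw [hE ζ hζ]
        ring
    refine ((((hdg ζ hζ).mul (hdg ζ hζ).conjugate).sub (dE.const_mul (1 / 4))).mul (hv ζ hζ)
      |>.congr_fun (Eventually.of_forall fun ξ => ?_)).congr_deriv ?_ ?_
    · simp only
      ring
    · simp only [map_neg, map_mul, hvc, map_div₀, hEc, map_ofNat]
      ring
    · simp only [map_add, map_pow]
      ring
  · exact hvc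
  · intro ζ
    simp only [map_mul, map_sub, conj_conj, map_div₀, map_ofNat, hEc, hvc]
    ring

lemma liouvilleForm_combination (v p q Y Y' Z Z' a b c d : ℂ) (hv : conj v = v)
    (hq : conj q = q) :
    liouvilleForm v p q (a * Y + b * Z) (a * Y' + b * Z') (c * Y + d * Z) (c * Y' + d * Z') =
      a * conj c * liouvilleForm v p q Y Y' Y Y' + a * conj d * liouvilleForm v p q Y Y' Z Z' +
      b * conj c * conj (liouvilleForm v p q Y Y' Z Z') +
      b * conj d * liouvilleForm v p q Z Z' Z Z' := by
  simp only [liouvilleForm, map_add, map_sub, map_mul, conj_conj, hv, hq]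
  ring

/-- A unimodular matrix preserving the Hermitian form `|x|² - |y|²` lies in `SU(1, 1)`. -/
lemma su_one_one_of_form {a b c d : ℂ} (h₁ : a * conj a - b * conj b = 1)
    (h₂ : a * conj c - b * conj d = 0) (h₃ : a * d - b * c = 1) : c = conj b ∧ d = conj a := by
  have h₄ : conj (a * conj c - b * conj d) = 0 := by rw [h₂, map_zero]
  simp only [map_sub, map_mul, conj_conj] at h₄
  constructor
  · linear_combination a * h₄ + conj b * h₃ - c * h₁
  · linear_combination b * h₄ + conj a * h₃ - d * h₁

/-- The **developing map** of a hyperbolic metric on the punctured disk, in homogeneous form: on the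
universal cover the metric is the pull-back of the hyperbolic metric of the unit disk by `y₂ / y₁`,
and the deck transformation acts on the pair `(y₁, y₂)` by an element of `SU(1, 1)`. -/
lemma IsConformalHyperbolicMetric.exists_developing_pair {ρ : ℂ → ℝ}
    (hρ : IsConformalHyperbolicMetric ρ puncturedDisk) :
    ∃ (y₁ y₁' y₂ y₂' : ℂ → ℂ) (a b : ℂ), ‖a‖ ^ 2 - ‖b‖ ^ 2 = 1 ∧ ∀ ζ ∈ leftHalfPlane,
      HasDerivAt y₁ (y₁' ζ) ζ ∧ HasDerivAt y₂ (y₂' ζ) ζ ∧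
      y₁ ζ * y₂' ζ - y₁' ζ * y₂ ζ = 1 ∧ ‖y₂ ζ‖ < ‖y₁ ζ‖ ∧
      ρ (exp ζ) * ‖exp ζ‖ ^ 2 = 4 / (‖y₁ ζ‖ ^ 2 - ‖y₂ ζ‖ ^ 2) ^ 2 ∧
      y₁ (ζ + 2 * Real.pi * I) = a * y₁ ζ + b * y₂ ζ ∧
      y₂ (ζ + 2 * Real.pi * I) = conj b * y₁ ζ + conj a * y₂ ζ := by
  obtain ⟨g, Q, hQ, hgQ⟩ := hρ.exists_schwarzian
  -- The data of the metric pulled back by `exp`.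
  set U : ℂ → ℂ := fun ζ => ((Real.log (ρ (exp ζ)) / 2 : ℝ) : ℂ) + (ζ + conj ζ) / 2 with hU
  set G : ℂ → ℂ := fun ζ => g (exp ζ) * exp ζ + 1 / 2 with hG
  set R : ℂ → ℂ := fun ζ => Q (exp ζ) * exp ζ ^ 2 - 1 / 4 with hR
  set E : ℂ → ℂ := fun ζ => ((ρ (exp ζ) * ‖exp ζ‖ ^ 2 : ℝ) : ℂ) with hE
  have hexpnorm : ∀ ζ, exp ζ * conj (exp ζ) = ((‖exp ζ‖ ^ 2 : ℝ) : ℂ) := fun ζ => by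
    rw [mul_conj, normSq_eq_norm_sq]
  have hUre : ∀ ζ, U ζ = ((Real.log (ρ (exp ζ)) / 2 + ζ.re : ℝ) : ℂ) := by
    intro ζ
    simp only [hU, add_conj]
    push_cast
    ring
  have hUc : ∀ ζ, conj (U ζ) = U ζ := fun ζ => by rw [hUre, conj_ofReal]
  have hEexp : ∀ ζ ∈ leftHalfPlane, E ζ = exp (2 * U ζ) := by
    intro ζ hζ
    have h0 := hρ.pos _ (exp_mem_puncturedDisk hζ)
    simp only [hE]
    rw [hUre, ← ofReal_ofNat, ← ofReal_mul, ← ofReal_exp]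
    congr 1
    rw [mul_add, Real.exp_add, mul_div_cancel₀ _ two_ne_zero, Real.exp_log h0, norm_exp,
      ← Real.exp_nat_mul]
    norm_num
  have hdU : ∀ ζ ∈ leftHalfPlane, HasWirtingerDerivAt U (G ζ) (conj (G ζ)) ζ := by
    intro ζ hζ
    have h1 := ((hgQ _ (exp_mem_puncturedDisk hζ)).1).comp_right (φ := exp) (hasDerivAt_exp ζ)
    have hid := HasWirtingerDerivAt.of_hasDerivAt (hasDerivAt_id ζ)
    refine ((h1.add ((hid.add hid.conjugate).const_mul (1 / 2))).congr_fun
      (Eventually.of_forall fun ξ => ?_)).congr_deriv ?_ ?_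
    · simp only [hU, id]
      ring
    · simp [hG]
    · simp only [hG, map_add, map_mul, map_div₀, map_one, map_ofNat]
      ring
  have hdG : ∀ ζ ∈ leftHalfPlane, HasWirtingerDerivAt G (R ζ + G ζ ^ 2) (E ζ / 4) ζ := by
    intro ζ hζ
    have h1 := ((hgQ _ (exp_mem_puncturedDisk hζ)).2).comp_right (φ := exp) (hasDerivAt_exp ζ)
    have h2 := HasWirtingerDerivAt.of_hasDerivAt (hasDerivAt_exp ζ)
    refine ((h1.mul h2).add (.const (1 / 2) ζ)).congr_deriv ?_ ?_
    · simp only [hR, hG]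
      ring
    · simp only [hE]
      rw [ofReal_mul, ← hexpnorm]
      ring
  have hEc : ∀ ζ, conj (E ζ) = E ζ := fun ζ => conj_ofReal _
  have hsys := liouvilleSystem_of_metric hUc hEexp hEc hdU hdG
  have hRd : DifferentiableOn ℂ R leftHalfPlane := by
    intro ζ hζ
    have h1 : DifferentiableAt ℂ Q (exp ζ) :=
      hQ.differentiableAt (isOpen_puncturedDisk.mem_nhds (exp_mem_puncturedDisk hζ))
    have h2 : DifferentiableAt ℂ (fun ζ => Q (exp ζ)) ζ :=
      DifferentiableAt.comp ζ h1 differentiableAt_exp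
    exact ((h2.mul (by fun_prop)).sub_const _).differentiableWithinAt
  have hUper : ∀ ζ, U (ζ + 2 * Real.pi * I) = U ζ := by
    intro ζ
    rw [hUre, hUre, exp_add_two_pi_I]
    simp
  have hEv : ∀ ζ ∈ leftHalfPlane, E ζ * (exp (-U ζ) * exp (-U ζ)) = 1 := by
    intro ζ hζ
    rw [hEexp ζ hζ, ← exp_add, ← exp_add,
      show 2 * U ζ + (-U ζ + -U ζ) = 0 by ring, exp_zero]
  have hvre : ∀ ζ, exp (-U ζ) = ((Real.exp (-(Real.log (ρ (exp ζ)) / 2 + ζ.re)) : ℝ) : ℂ) := by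
    intro ζ
    rw [hUre, ofReal_exp, ofReal_neg]
  obtain ⟨y₁, y₁', y₂, y₂', s1, s2, hy⟩ := hsys.exists_solutions hRd
    (by rw [hvre, ofReal_re]; exact Real.exp_pos _) (by
      have := hEv _ neg_one_mem_leftHalfPlane
      simp only [map_neg, map_mul]
      rw [← exp_conj, map_neg, hUc]
      linear_combination (-1 / 4) * this)
  have hRper : ∀ ζ, R (ζ + 2 * Real.pi * I) = R ζ := by
    intro ζ
    simp only [hR, exp_add_two_pi_I]
  obtain ⟨a, b, hab⟩ := s1.eq_combination s2 (s1.translate hRper) (fun ζ hζ => (hy ζ hζ).1)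
  obtain ⟨c, d, hcd⟩ := s1.eq_combination s2 (s2.translate hRper) (fun ζ hζ => (hy ζ hζ).1)
  obtain ⟨w, -, f11, f12, f22⟩ := hy _ neg_one_mem_leftHalfPlane
  obtain ⟨w', -, g11, g12, g22⟩ := hy _ (add_two_pi_I_mem neg_one_mem_leftHalfPlane)
  obtain ⟨ha, ha'⟩ := hab _ neg_one_mem_leftHalfPlane
  obtain ⟨hc, hc'⟩ := hcd _ neg_one_mem_leftHalfPlane
  have hGper : G (-1 + 2 * Real.pi * I) = G (-1) := by
    simp only [hG, exp_add_two_pi_I]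
  have hEper : E (-1 + 2 * Real.pi * I) = E (-1) := by
    simp only [hE, exp_add_two_pi_I]
  simp only [hUper, hGper, hEper] at g11 g12
  rw [ha, ha'] at g11 g12 w'
  rw [hc, hc'] at g12 w'
  have hvc := hsys.conj_v (-1)
  have hqc := hsys.conj_q (-1)
  rw [liouvilleForm_combination _ _ _ _ _ _ _ _ _ _ _ hvc hqc, f11, f12, f22] at g11 g12
  rw [map_zero] at g11 g12
  have k1 : a * conj a - b * conj b = 1 := by linear_combination (-2) * g11
  have k2 : a * conj c - b * conj d = 0 := by linear_combination (-2) * g12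
  have k3 : a * d - b * c = 1 := by linear_combination w' - (a * d - b * c) * w
  obtain ⟨rfl, rfl⟩ := su_one_one_of_form k1 k2 k3
  refine ⟨y₁, y₁', y₂, y₂', a, b, ?_, fun ζ hζ => ?_⟩
  · rw [mul_conj, mul_conj, normSq_eq_norm_sq, normSq_eq_norm_sq] at k1
    exact_mod_cast k1
  obtain ⟨w1, w2, -⟩ := hy ζ hζ
  have hpos := Real.exp_pos (-(Real.log (ρ (exp ζ)) / 2 + ζ.re))
  have hvζ := hvre ζ
  have hEvζ := hEv ζ hζ
  generalize Real.exp (-(Real.log (ρ (exp ζ)) / 2 + ζ.re)) = t at hpos hvζ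
  simp only [hvζ] at w2
  rw [mul_conj, mul_conj, normSq_eq_norm_sq, normSq_eq_norm_sq] at w2
  have w3 : 2 * t = ‖y₁ ζ‖ ^ 2 - ‖y₂ ζ‖ ^ 2 := by exact_mod_cast w2
  refine ⟨(s1 ζ hζ).1, (s2 ζ hζ).1, w1, ?_, ?_, (hab ζ hζ).1, (hcd ζ hζ).1⟩
  · refine lt_of_pow_lt_pow_left₀ 2 (norm_nonneg _) ?_
    linarith
  · rw [← w3, eq_div_iff (by positivity)]
    rw [hvζ] at hEvζ
    simp only [hE] at hEvζ
    have : ρ (exp ζ) * ‖exp ζ‖ ^ 2 * (t * t) = 1 := by exact_mod_cast hEvζ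
    linear_combination 4 * this

/-! ### Normal forms of the monodromy -/

/-- An element of `SU(1, 1)` has a fixed point in the closed unit disk: reflection in the unit
circle exchanges the roots of the fixed-point equation. -/
lemma exists_fixedPoint (a b : ℂ) :
    ∃ x : ℂ, ‖x‖ ≤ 1 ∧ b * x ^ 2 + (a - conj a) * x - conj b = 0 := by
  by_cases hb : b = 0
  · exact ⟨0, by simp, by simp [hb]⟩
  obtain ⟨s, hs⟩ := IsAlgClosed.exists_pow_nat_eq (discrim b (a - conj a) (-conj b)) two_pos
  obtain ⟨x, hx⟩ := exists_quadratic_eq_zero hb ⟨s, by rw [← hs, pow_two]⟩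
  have hx' : b * x ^ 2 + (a - conj a) * x - conj b = 0 := by linear_combination hx
  by_cases h : ‖x‖ ≤ 1
  · exact ⟨x, h, hx'⟩
  push Not at h
  have hx0 : conj x ≠ 0 := by
    rw [Ne, map_eq_zero, ← norm_eq_zero]
    linarith
  refine ⟨(conj x)⁻¹, ?_, ?_⟩
  · rw [norm_inv, norm_conj]
    exact inv_le_one_of_one_le₀ h.le
  · have hc := congrArg conj hx'
    simp only [map_sub, map_add, map_mul, map_pow, conj_conj, map_zero] at hc
    field_simp
    linear_combination -hc

/-- The metric `ρ |dw|²` on the punctured unit disk, pulled back to the left half-plane by `exp`, is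
the pull-back under `f` of the hyperbolic metric of the unit disk, and the deck transformation acts
as the rotation by `m`. -/
structure EllipticDevelopment (ρ : ℂ → ℝ) (f f' : ℂ → ℂ) (m : ℂ) : Prop where
  norm_m : ‖m‖ = 1
  hasDerivAt : ∀ ζ ∈ leftHalfPlane, HasDerivAt f (f' ζ) ζ
  norm_lt : ∀ ζ ∈ leftHalfPlane, ‖f ζ‖ < 1
  monodromy : ∀ ζ ∈ leftHalfPlane, f (ζ + 2 * Real.pi * I) = m * f ζ
  metric : ∀ ζ ∈ leftHalfPlane,
    ρ (exp ζ) * ‖exp ζ‖ ^ 2 = 4 * ‖f' ζ‖ ^ 2 / (1 - ‖f ζ‖ ^ 2) ^ 2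

/-- The metric `ρ |dw|²` on the punctured unit disk, pulled back to the left half-plane by `exp`, is
the pull-back under `F` of the hyperbolic metric of the right half-plane, and the deck transformation
acts as `F ↦ k F + i b`. -/
structure AffineDevelopment (ρ : ℂ → ℝ) (F F' : ℂ → ℂ) (k b : ℝ) : Prop where
  k_pos : 0 < k
  hasDerivAt : ∀ ζ ∈ leftHalfPlane, HasDerivAt F (F' ζ) ζ
  re_pos : ∀ ζ ∈ leftHalfPlane, 0 < (F ζ).re
  monodromy : ∀ ζ ∈ leftHalfPlane, F (ζ + 2 * Real.pi * I) = k * F ζ + I * b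
  metric : ∀ ζ ∈ leftHalfPlane,
    ρ (exp ζ) * ‖exp ζ‖ ^ 2 = ‖F' ζ‖ ^ 2 / (F ζ).re ^ 2

/-- A fixed point of the monodromy inside the disk is moved to the centre; one on the boundary is
moved to the point at infinity of the right half-plane. -/
lemma IsConformalHyperbolicMetric.elliptic_or_affine {ρ : ℂ → ℝ}
    (hρ : IsConformalHyperbolicMetric ρ puncturedDisk) :
    (∃ f f' m, EllipticDevelopment ρ f f' m) ∨ ∃ F F' k b, AffineDevelopment ρ F F' k b := by
  obtain ⟨y₁, y₁', y₂, y₂', a, b, hab, hy⟩ := hρ.exists_developing_pair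
  obtain ⟨x, hx1, hx⟩ := exists_fixedPoint a b
  rcases hx1.lt_or_eq with hlt | heq
  · left
    have hxx : 0 < 1 - ‖x‖ ^ 2 := by nlinarith [norm_nonneg x]
    have hcx : x * conj x = ((‖x‖ ^ 2 : ℝ) : ℂ) := by rw [mul_conj, normSq_eq_norm_sq]
    have hcb := congrArg conj hx
    simp only [map_sub, map_add, map_mul, map_pow, conj_conj, map_zero] at hcb
    have hG0 : ∀ ζ ∈ leftHalfPlane, y₁ ζ - conj x * y₂ ζ ≠ 0 := by
      intro ζ hζ h
      obtain ⟨-, -, -, hlt', -⟩ := hy ζ hζ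
      rw [sub_eq_zero.1 h, norm_mul, norm_conj] at hlt'
      nlinarith [norm_nonneg (y₂ ζ), norm_nonneg x]
    have hsq : ∀ ζ, ‖y₁ ζ - conj x * y₂ ζ‖ ^ 2 - ‖y₂ ζ - x * y₁ ζ‖ ^ 2 =
        (1 - ‖x‖ ^ 2) * (‖y₁ ζ‖ ^ 2 - ‖y₂ ζ‖ ^ 2) := by
      intro ζ
      simp only [← normSq_eq_norm_sq, normSq_apply, sub_re, sub_im, mul_re, mul_im, conj_re,
        conj_im]
      ring
    have hμ : conj a - x * b ≠ 0 := by
      intro h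
      have h1 : ‖a‖ = ‖x‖ * ‖b‖ := by
        rw [← norm_mul, ← sub_eq_zero.1 h, norm_conj]
      nlinarith [norm_nonneg x, norm_nonneg b, mul_nonneg (norm_nonneg x) (norm_nonneg b)]
    refine ⟨fun ζ => (y₂ ζ - x * y₁ ζ) / (y₁ ζ - conj x * y₂ ζ),
      fun ζ => (1 - ‖x‖ ^ 2 : ℝ) / (y₁ ζ - conj x * y₂ ζ) ^ 2,
      (conj a - x * b) / conj (conj a - x * b), ?_, ?_, ?_, ?_, ?_⟩
    · rw [norm_div, norm_conj, div_self (norm_ne_zero_iff.2 hμ)]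
    · intro ζ hζ
      obtain ⟨d1, d2, w, -⟩ := hy ζ hζ
      refine ((d2.sub (d1.const_mul x)).div (d1.sub (d2.const_mul (conj x)))
        (hG0 ζ hζ)).congr_deriv ?_
      congr 1
      simp only [Pi.sub_apply]
      push_cast
      push_cast at hcx
      rw [← hcx]
      linear_combination (1 - x * conj x) * w
    · intro ζ hζ
      obtain ⟨-, -, -, hlt', -⟩ := hy ζ hζ
      rw [norm_div, div_lt_one (norm_pos_iff.2 (hG0 ζ hζ))]
      refine lt_of_pow_lt_pow_left₀ 2 (norm_nonneg _) ?_
      have h1 : ‖y₂ ζ‖ ^ 2 < ‖y₁ ζ‖ ^ 2 := by gcongr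
      nlinarith [hsq ζ]
    · intro ζ hζ
      obtain ⟨-, -, -, -, -, m1, m2⟩ := hy ζ hζ
      have e1 : y₂ (ζ + 2 * Real.pi * I) - x * y₁ (ζ + 2 * Real.pi * I) =
          (conj a - x * b) * (y₂ ζ - x * y₁ ζ) := by
        rw [m1, m2]
        linear_combination (-y₁ ζ) * hx
      have e2 : y₁ (ζ + 2 * Real.pi * I) - conj x * y₂ (ζ + 2 * Real.pi * I) =
          conj (conj a - x * b) * (y₁ ζ - conj x * y₂ ζ) := by
        rw [m1, m2]
        simp only [map_sub, map_mul, conj_conj]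
        linear_combination (-y₂ ζ) * hcb
      rw [e1, e2, mul_div_mul_comm]
    · intro ζ hζ
      obtain ⟨-, -, -, hlt', hmet, -⟩ := hy ζ hζ
      have hG := norm_pos_iff.2 (hG0 ζ hζ)
      have h1 : 0 < ‖y₁ ζ‖ ^ 2 - ‖y₂ ζ‖ ^ 2 := by
        have : ‖y₂ ζ‖ ^ 2 < ‖y₁ ζ‖ ^ 2 := by gcongr
        linarith
      have h2 : 1 - ‖(y₂ ζ - x * y₁ ζ) / (y₁ ζ - conj x * y₂ ζ)‖ ^ 2 =
          (1 - ‖x‖ ^ 2) * (‖y₁ ζ‖ ^ 2 - ‖y₂ ζ‖ ^ 2) / ‖y₁ ζ - conj x * y₂ ζ‖ ^ 2 := by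
        rw [← hsq, norm_div, div_pow, sub_div, div_self (by positivity)]
      rw [hmet, h2, norm_div, norm_pow, norm_real, Real.norm_of_nonneg hxx.le]
      field_simp
  · right
    have hx0 : x * conj x = 1 := by rw [mul_conj, normSq_eq_norm_sq, heq]; simp
    set α := a.re with hα
    set β := a.im with hβ
    set γ := (x * b).re with hγ
    set δ := (x * b).im with hδ
    have ha : a = α + β * I := (re_add_im a).symm
    have hac : conj a = α - β * I := by apply Complex.ext <;> simp [hα, hβ]
    have hxb : x * b = γ + δ * I := (re_add_im _).symm
    have hxbc : conj x * conj b = γ - δ * I := by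
      rw [← map_mul, hγ, hδ]
      generalize x * b = t
      apply Complex.ext <;> simp
    have him : δ = -β := by
      have h1 : x * b + (a - conj a) - conj x * conj b = 0 := by
        linear_combination conj x * hx - (x * b + a - conj a) * hx0
      rw [hac, ha, hxb, hxbc] at h1
      have h2 := congrArg Complex.im h1
      simp at h2
      linarith
    have hdet : (α + γ) * (α - γ) = 1 := by
      have h1 : ‖a‖ ^ 2 = α ^ 2 + β ^ 2 := by
        rw [← normSq_eq_norm_sq, normSq_apply]
        ring
      have h2 : ‖b‖ ^ 2 = γ ^ 2 + δ ^ 2 := by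
        have : ‖b‖ = ‖x * b‖ := by rw [norm_mul, heq, one_mul]
        rw [this, ← normSq_eq_norm_sq, normSq_apply]
        ring
      rw [h1, h2, him] at hab
      linear_combination hab
    have hk : α + γ ≠ 0 := left_ne_zero_of_mul_eq_one hdet
    have hE0 : ∀ ζ ∈ leftHalfPlane, x * y₁ ζ - y₂ ζ ≠ 0 := by
      intro ζ hζ h
      obtain ⟨-, -, -, hlt', -⟩ := hy ζ hζ
      rw [← sub_eq_zero.1 h, norm_mul, heq, one_mul] at hlt'
      exact lt_irrefl _ hlt'
    have hre : ∀ ζ, ((x * y₁ ζ + y₂ ζ) / (x * y₁ ζ - y₂ ζ)).re =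
        (‖y₁ ζ‖ ^ 2 - ‖y₂ ζ‖ ^ 2) / ‖x * y₁ ζ - y₂ ζ‖ ^ 2 := by
      intro ζ
      have h1 : ‖y₁ ζ‖ = ‖x * y₁ ζ‖ := by rw [norm_mul, heq, one_mul]
      rw [h1, div_re]
      generalize x * y₁ ζ = p
      generalize y₂ ζ = q
      simp only [← normSq_eq_norm_sq, ← add_div]
      congr 1
      simp only [normSq_apply, add_re, sub_re, add_im, sub_im]
      ring
    refine ⟨fun ζ => (x * y₁ ζ + y₂ ζ) / (x * y₁ ζ - y₂ ζ),
      fun ζ => 2 * x / (x * y₁ ζ - y₂ ζ) ^ 2, (α + γ) ^ 2, 2 * β * (α + γ), by positivity,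
      ?_, ?_, ?_, ?_⟩
    · intro ζ hζ
      obtain ⟨d1, d2, w, -⟩ := hy ζ hζ
      refine (((d1.const_mul x).add d2).div ((d1.const_mul x).sub d2)
        (hE0 ζ hζ)).congr_deriv ?_
      congr 1
      simp only [Pi.sub_apply, Pi.add_apply]
      linear_combination (2 * x) * w
    · intro ζ hζ
      obtain ⟨-, -, -, hlt', -⟩ := hy ζ hζ
      rw [hre]
      have : ‖y₂ ζ‖ ^ 2 < ‖y₁ ζ‖ ^ 2 := by gcongr
      exact div_pos (by linarith) (by have := norm_pos_iff.2 (hE0 ζ hζ); positivity)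
    · intro ζ hζ
      obtain ⟨-, -, -, -, -, m1, m2⟩ := hy ζ hζ
      have h0 := hE0 ζ hζ
      have hdetC : ((α : ℂ) + γ) * (α - γ) = 1 := by exact_mod_cast hdet
      have hm : (α : ℂ) - γ ≠ 0 := right_ne_zero_of_mul_eq_one hdetC
      have hδC : (δ : ℂ) = -β := by exact_mod_cast him
      rw [hδC] at hxb hxbc
      have e1 : x * y₁ (ζ + 2 * Real.pi * I) - y₂ (ζ + 2 * Real.pi * I) =
          (α - γ) * (x * y₁ ζ - y₂ ζ) := by
        rw [m1, m2]
        linear_combination (x * y₁ ζ) * ha - (y₂ ζ) * hac + y₂ ζ * hxb - x * y₁ ζ * hxbc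
          + y₁ ζ * conj b * hx0
      have e2 : x * y₁ (ζ + 2 * Real.pi * I) + y₂ (ζ + 2 * Real.pi * I) =
          (α + γ) * (x * y₁ ζ + y₂ ζ) + 2 * I * β * (x * y₁ ζ - y₂ ζ) := by
        rw [m1, m2]
        linear_combination (x * y₁ ζ) * ha + (y₂ ζ) * hac + y₂ ζ * hxb + x * y₁ ζ * hxbc
          - y₁ ζ * conj b * hx0
      rw [e1, e2]
      push_cast
      rw [div_eq_iff (mul_ne_zero hm h0)]
      field_simp
      linear_combination (-((α : ℂ) + γ) * (x * y₁ ζ + y₂ ζ)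
        - 2 * I * β * (x * y₁ ζ - y₂ ζ)) * hdetC
    · intro ζ hζ
      obtain ⟨-, -, -, hlt', hmet, -⟩ := hy ζ hζ
      have hG := norm_pos_iff.2 (hE0 ζ hζ)
      have h1 : 0 < ‖y₁ ζ‖ ^ 2 - ‖y₂ ζ‖ ^ 2 := by
        have : ‖y₂ ζ‖ ^ 2 < ‖y₁ ζ‖ ^ 2 := by gcongr
        linarith
      rw [hmet, hre, norm_div, norm_pow, norm_mul, heq]
      simp only [Complex.norm_ofNat, mul_one]
      field_simp
      norm_num

/-! ### Functions of `exp ζ` -/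

lemma exists_log_mem {w : ℂ} (hw : w ∈ puncturedDisk) : ∃ ζ ∈ leftHalfPlane, exp ζ = w := by
  have h0 : w ≠ 0 := hw.2
  have h1 : ‖w‖ < 1 := by simpa using hw.1
  refine ⟨log w, ?_, exp_log h0⟩
  simp only [leftHalfPlane, mem_ofPred_eq, log_re]
  exact Real.log_neg (norm_pos_iff.2 h0) h1

lemma mem_leftHalfPlane_of_exp {ζ : ℂ} (h : exp ζ ∈ ball (0 : ℂ) 1) : ζ ∈ leftHalfPlane := by
  rw [mem_ball_zero_iff, norm_exp, Real.exp_lt_one_iff] at h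
  exact h

lemma eq_of_exp_eq {G : ℂ → ℂ} (hG : ∀ ζ ∈ leftHalfPlane, G (ζ + 2 * Real.pi * I) = G ζ)
    {ζ ξ : ℂ} (hζ : ζ ∈ leftHalfPlane) (h : exp ζ = exp ξ) : G ζ = G ξ := by
  have hnat : ∀ (n : ℕ) (η : ℂ), η ∈ leftHalfPlane → G (η + n * (2 * Real.pi * I)) = G η := by
    intro n
    induction n with
    | zero => simp
    | succ n ih =>
      intro η hη
      have : η + n * (2 * Real.pi * I) ∈ leftHalfPlane := by simpa [leftHalfPlane] using hη
      rw [← ih η hη, ← hG _ this]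
      congr 1
      push_cast
      ring
  obtain ⟨n, hn⟩ := exp_eq_exp_iff_exists_int.1 h
  have hξ : ξ ∈ leftHalfPlane := by
    have h1 : ‖exp ζ‖ = ‖exp ξ‖ := by rw [h]
    rw [norm_exp, norm_exp, Real.exp_eq_exp] at h1
    simp only [leftHalfPlane, mem_ofPred_eq] at hζ ⊢
    rwa [← h1]
  obtain ⟨m, rfl | rfl⟩ := n.eq_nat_or_neg
  · rw [hn]
    exact_mod_cast hnat m ξ hξ
  · have : ξ = ζ + m * (2 * Real.pi * I) := by
      rw [hn]
      push_cast
      ring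
    rw [this, hnat m ζ hζ]

/-- A `2πi`-periodic bounded holomorphic function on the left half-plane is a holomorphic function
of `exp ζ`, and the puncture is a removable singularity. -/
lemma exists_descent {G : ℂ → ℂ} (hd : DifferentiableOn ℂ G leftHalfPlane)
    (hG : ∀ ζ ∈ leftHalfPlane, G (ζ + 2 * Real.pi * I) = G ζ) {C : ℝ}
    (hC : ∀ ζ ∈ leftHalfPlane, ‖G ζ‖ ≤ C) :
    ∃ h : ℂ → ℂ, DifferentiableOn ℂ h (ball 0 1) ∧ ∀ ζ ∈ leftHalfPlane, h (exp ζ) = G ζ := by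
  set h : ℂ → ℂ := fun w => G (log w) with hh
  have hexp : ∀ ζ ∈ leftHalfPlane, h (exp ζ) = G ζ := fun ζ hζ =>
    (eq_of_exp_eq hG hζ (exp_log (exp_ne_zero ζ)).symm).symm
  have hdiff : DifferentiableOn ℂ h (ball 0 1 \ {0}) := by
    intro w hw
    obtain ⟨ζ, hζ, rfl⟩ := exists_log_mem hw
    have hs : HasStrictDerivAt exp (exp ζ) ζ := hasStrictDerivAt_exp ζ
    have hinv := hs.to_localInverse (exp_ne_zero ζ)
    set e := hs.localInverse exp (exp ζ) ζ (exp_ne_zero ζ) with he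
    have he0 : e (exp ζ) = ζ := HasStrictFDerivAt.localInverse_apply_image _
    have hright : ∀ᶠ x in 𝓝 (exp ζ), exp (e x) = x := HasStrictFDerivAt.eventually_right_inverse _
    have hmem : ∀ᶠ x in 𝓝 (exp ζ), e x ∈ leftHalfPlane := by
      refine hinv.hasDerivAt.continuousAt.eventually ?_
      rw [he0]
      exact isOpen_leftHalfPlane.mem_nhds hζ
    have hGe : DifferentiableAt ℂ (fun x => G (e x)) (exp ζ) := by
      refine DifferentiableAt.comp (exp ζ) ?_ hinv.hasDerivAt.differentiableAt
      rw [he0]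
      exact hd.differentiableAt (isOpen_leftHalfPlane.mem_nhds hζ)
    refine (hGe.congr_of_eventuallyEq ?_).differentiableWithinAt
    filter_upwards [hright, hmem] with x h1 h2
    rw [← hexp _ h2, h1]
  have hnhds : ball (0 : ℂ) 1 ∈ 𝓝 (0 : ℂ) := ball_mem_nhds _ one_pos
  have hbdd : BddAbove (norm ∘ h '' (ball 0 1 \ {0})) := by
    refine ⟨C, ?_⟩
    rintro _ ⟨w, hw, rfl⟩
    obtain ⟨ζ, hζ, rfl⟩ := exists_log_mem hw
    simp only [Function.comp, hexp ζ hζ]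
    exact hC ζ hζ
  refine ⟨_, differentiableOn_update_limUnder_of_bddAbove hnhds hdiff hbdd, fun ζ hζ => ?_⟩
  rw [Function.update_of_ne (exp_ne_zero ζ), hexp ζ hζ]

lemma exists_local_log {k : ℂ → ℂ} (hk : AnalyticAt ℂ k 0) (h0 : k 0 ≠ 0) :
    ∃ l : ℂ → ℂ, AnalyticAt ℂ l 0 ∧ ∀ᶠ w in 𝓝 (0 : ℂ), exp (l w) = k w := by
  have h1 : AnalyticAt ℂ (fun w => k w / k 0) 0 := hk.div analyticAt_const h0
  refine ⟨fun w => log (k w / k 0) + log (k 0), (h1.clog ?_).add analyticAt_const, ?_⟩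
  · rw [div_self h0]
    exact one_mem_slitPlane
  · filter_upwards [hk.continuousAt.eventually_ne h0] with w hw
    rw [exp_add, exp_log (div_ne_zero hw h0), exp_log h0, div_mul_cancel₀ _ h0]

/-- If `h(e^ζ) = exp(N ζ)` with `h` holomorphic at `0`, then the increment of `N` over a deck
transformation counts the order of vanishing of `h` at `0`. -/
lemma order_eq_monodromy {h N : ℂ → ℂ} (hh : AnalyticAt ℂ h 0)
    (hN : DifferentiableOn ℂ N leftHalfPlane)
    (hNh : ∀ ζ ∈ leftHalfPlane, exp (N ζ) = h (exp ζ)) :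
    ∃ (n : ℕ) (k : ℂ → ℂ), AnalyticAt ℂ k 0 ∧ k 0 ≠ 0 ∧
      (∀ᶠ w in 𝓝 (0 : ℂ), h w = w ^ n * k w) ∧
      ∃ ζ ∈ leftHalfPlane, N (ζ + 2 * Real.pi * I) = N ζ + n * (2 * Real.pi * I) := by
  have hne : ¬ ∀ᶠ w in 𝓝 (0 : ℂ), h w = 0 := by
    intro hev
    obtain ⟨ε, hε, hb⟩ := Metric.eventually_nhds_iff_ball.1 hev
    have hm : ((min ε 1 / 2 : ℝ) : ℂ) ∈ puncturedDisk := by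
      have : 0 < min ε 1 := lt_min hε one_pos
      refine ⟨?_, by simpa using this.ne'⟩
      rw [mem_ball_zero_iff, norm_real, Real.norm_of_nonneg (by positivity)]
      linarith [min_le_right ε 1]
    obtain ⟨ζ, hζ, hζe⟩ := exists_log_mem hm
    refine exp_ne_zero (N ζ) ?_
    rw [hNh ζ hζ, hζe]
    refine hb _ ?_
    have : 0 < min ε 1 := lt_min hε one_pos
    rw [mem_ball_zero_iff, norm_real, Real.norm_of_nonneg (by positivity)]
    linarith [min_le_left ε 1]
  obtain ⟨n, k, hk, hk0, hev⟩ := hh.exists_eventuallyEq_pow_smul_nonzero_iff.2 hne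
  obtain ⟨l, hl, hlk⟩ := exists_local_log hk hk0
  refine ⟨n, k, hk, hk0, by simpa using hev, ?_⟩
  obtain ⟨ε, hε, hb⟩ := Metric.eventually_nhds_iff_ball.1
    ((hev.and hlk).and hl.eventually_analyticAt)
  -- On the half-plane `Re ζ < log ε` the functions `N` and `n ζ + l(e^ζ)` differ by a constant.
  set R := min (Real.log ε) 0 with hR
  have hmem : ∀ ζ : ℂ, ζ.re < R → ζ ∈ leftHalfPlane ∧ exp ζ ∈ ball (0 : ℂ) ε := by
    intro ζ hζ
    refine ⟨lt_of_lt_of_le hζ (min_le_right _ _), ?_⟩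
    rw [mem_ball_zero_iff, norm_exp, ← Real.lt_log_iff_exp_lt hε]
    exact lt_of_lt_of_le hζ (min_le_left _ _)
  have hone : ∀ ζ : ℂ, ζ.re < R → exp (N ζ - n * ζ - l (exp ζ)) = 1 := by
    intro ζ hζ
    obtain ⟨h1, h2⟩ := hmem ζ hζ
    obtain ⟨⟨h3, h4⟩, -⟩ := hb _ h2
    rw [exp_sub, exp_sub, hNh ζ h1, h3, h4, exp_nat_mul]
    simp only [sub_zero, smul_eq_mul]
    have := exp_ne_zero ζ
    have hk' : k (exp ζ) ≠ 0 := by rw [← h4]; exact exp_ne_zero _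
    field_simp
  have hdiff : ∀ ζ : ℂ, ζ.re < R →
      DifferentiableAt ℂ (fun ζ => N ζ - n * ζ - l (exp ζ)) ζ := by
    intro ζ hζ
    obtain ⟨h1, h2⟩ := hmem ζ hζ
    have h3 : DifferentiableAt ℂ N ζ := hN.differentiableAt (isOpen_leftHalfPlane.mem_nhds h1)
    have h4 : DifferentiableAt ℂ (fun ζ => l (exp ζ)) ζ :=
      DifferentiableAt.comp ζ (hb _ h2).2.differentiableAt differentiableAt_exp
    exact (h3.sub (by fun_prop)).sub h4
  have hopen : IsOpen {ζ : ℂ | ζ.re < R} := isOpen_lt continuous_re continuous_const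
  have hder : ∀ ζ : ℂ, ζ.re < R → HasWirtingerDerivAt (fun ζ => N ζ - n * ζ - l (exp ζ)) 0 0 ζ := by
    intro ζ hζ
    have h1 := (hdiff ζ hζ).hasDerivAt
    have h2 := h1.cexp
    have h3 : HasDerivAt (fun ζ => exp (N ζ - n * ζ - l (exp ζ))) 0 ζ := by
      refine (hasDerivAt_const ζ (1 : ℂ)).congr_of_eventuallyEq ?_
      filter_upwards [hopen.mem_nhds hζ] with ξ hξ using hone ξ hξ
    have h4 := h2.unique h3
    rw [hone ζ hζ, one_mul] at h4
    rw [h4] at h1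
    exact .of_hasDerivAt h1
  have hR' : ((R - 1 : ℝ) : ℂ).re < R := by simp
  have hR'' : (((R - 1 : ℝ) : ℂ) + 2 * Real.pi * I).re < R := by simp
  refine ⟨((R - 1 : ℝ) : ℂ), (hmem _ hR').1, ?_⟩
  have := HasWirtingerDerivAt.eq_on_convex hopen (convex_halfSpace_re_lt R) hder hR'' hR'
  rw [exp_add_two_pi_I] at this
  linear_combination this

lemma exists_injOn_ball {z : ℂ → ℂ} (hz : AnalyticAt ℂ z 0) (hd : deriv z 0 ≠ 0) :
    ∃ ε > 0, InjOn z (ball 0 ε) ∧ DifferentiableOn ℂ z (ball 0 ε) := by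
  have hs : HasStrictDerivAt z (deriv z 0) 0 := hz.hasStrictDerivAt
  have hleft := HasStrictFDerivAt.eventually_left_inverse (hs.hasStrictFDerivAt_equiv hd)
  obtain ⟨ε, hε, hb⟩ := Metric.eventually_nhds_iff_ball.1 (hleft.and hz.eventually_analyticAt)
  refine ⟨ε, hε, fun x hx y hy hxy => ?_, fun x hx =>
    (hb x hx).2.differentiableAt.differentiableWithinAt⟩
  rw [← (hb x hx).1, ← (hb y hy).1, hxy]

/-- A function `z = exp N(ζ)` of `w = e^ζ`, with nonzero derivative at `0`, is a coordinate near `0`,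
and the metric in it is computed from `dz / z = N' dζ`. -/
lemma exists_coordinate {ρ : ℂ → ℝ} {z N N' : ℂ → ℂ} {τ : ℂ → ℝ} (hz : AnalyticAt ℂ z 0)
    (hz0 : z 0 = 0) (hd : deriv z 0 ≠ 0)
    (h : ∀ᶠ w in 𝓝 (0 : ℂ), ∀ ζ, exp ζ = w → HasDerivAt N (N' ζ) ζ ∧ z w = exp (N ζ) ∧
      ρ w * ‖w‖ ^ 2 = τ w * (‖z w‖ ^ 2 * ‖N' ζ‖ ^ 2)) :
    ∃ ε, 0 < ε ∧ ε ≤ 1 ∧ IsCenteredCoordinate z (ball 0 ε) ∧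
      MetricEqInCoordinate ρ (ball 0 ε) z τ := by
  obtain ⟨δ, hδ, hinj, hdiff⟩ := exists_injOn_ball hz hd
  obtain ⟨η, hη, hb⟩ := Metric.eventually_nhds_iff_ball.1 h
  set ε := min (min δ η) 1 with hε
  have h1 : ball (0 : ℂ) ε ⊆ ball 0 δ :=
    ball_subset_ball ((min_le_left _ _).trans (min_le_left _ _))
  have h2 : ball (0 : ℂ) ε ⊆ ball 0 η :=
    ball_subset_ball ((min_le_left _ _).trans (min_le_right _ _))
  have hε0 : 0 < ε := lt_min (lt_min hδ hη) one_pos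
  refine ⟨ε, hε0, min_le_right _ _, ⟨isOpen_ball, mem_ball_self hε0, hdiff.mono h1,
    hinj.mono h1, hz0⟩, fun w hw => ?_⟩
  have hw0 : w ≠ 0 := hw.2
  have hζ : exp (log w) = w := exp_log hw0
  obtain ⟨hN, hzN, hmet⟩ := hb w (h2 hw.1) (log w) hζ
  have hzd : HasDerivAt z (deriv z w) (exp (log w)) := by
    rw [hζ]
    exact (hdiff.differentiableAt (isOpen_ball.mem_nhds (h1 hw.1))).hasDerivAt
  have e1 : HasDerivAt (fun ζ => z (exp ζ)) (deriv z w * w) (log w) := by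
    have := HasDerivAt.comp (log w) hzd (hasDerivAt_exp (log w))
    rwa [hζ] at this
  have e2 : HasDerivAt (fun ζ => z (exp ζ)) (exp (N (log w)) * N' (log w)) (log w) := by
    refine hN.cexp.congr_of_eventuallyEq ?_
    have : ∀ᶠ ζ in 𝓝 (log w), exp ζ ∈ ball (0 : ℂ) η := by
      refine continuous_exp.continuousAt.eventually (isOpen_ball.mem_nhds ?_)
      rw [hζ]
      exact h2 hw.1
    filter_upwards [this] with ζ hζ' using (hb _ hζ' ζ rfl).2.1
  have e3 := e1.unique e2
  rw [← hzN] at e3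
  have e4 : ‖deriv z w‖ * ‖w‖ = ‖z w‖ * ‖N' (log w)‖ := by rw [← norm_mul, e3, norm_mul]
  have hw' : ‖w‖ ^ 2 ≠ 0 := pow_ne_zero 2 (norm_ne_zero_iff.2 hw0)
  refine mul_right_cancel₀ hw' ?_
  rw [hmet, ← mul_pow, ← e4]
  ring

/-! ### Elliptic monodromy: conical normal form -/

lemma EllipticDevelopment.deriv_ne_zero {ρ : ℂ → ℝ} (hρ : ∀ w ∈ puncturedDisk, 0 < ρ w)
    {f f' : ℂ → ℂ} {m : ℂ} (h : EllipticDevelopment ρ f f' m) {ζ : ℂ} (hζ : ζ ∈ leftHalfPlane) :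
    f' ζ ≠ 0 := by
  intro h0
  have h1 := h.metric ζ hζ
  rw [h0] at h1
  have h2 := hρ _ (exp_mem_puncturedDisk hζ)
  have h3 : 0 < ‖exp ζ‖ := norm_pos_iff.2 (exp_ne_zero ζ)
  have : 0 < ρ (exp ζ) * ‖exp ζ‖ ^ 2 := by positivity
  rw [h1] at this
  simp at this

/-- A disk automorphism applied to a development with trivial monodromy. -/
lemma EllipticDevelopment.moebius {ρ : ℂ → ℝ} {f f' : ℂ → ℂ} (h : EllipticDevelopment ρ f f' 1)
    {p : ℂ} (hp : ‖p‖ < 1) :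
    EllipticDevelopment ρ (fun ζ => (f ζ - p) / (1 - conj p * f ζ))
      (fun ζ => (1 - ‖p‖ ^ 2 : ℝ) * f' ζ / (1 - conj p * f ζ) ^ 2) 1 := by
  have hpp : 0 < 1 - ‖p‖ ^ 2 := by nlinarith [norm_nonneg p]
  have h0 : ∀ ζ ∈ leftHalfPlane, 1 - conj p * f ζ ≠ 0 := by
    intro ζ hζ h1
    have h2 : ‖conj p * f ζ‖ = 1 := by rw [← sub_eq_zero.1 h1, norm_one]
    rw [norm_mul, norm_conj] at h2
    nlinarith [norm_nonneg p, norm_nonneg (f ζ), h.norm_lt ζ hζ]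
  have hsq : ∀ ζ, ‖1 - conj p * f ζ‖ ^ 2 - ‖f ζ - p‖ ^ 2 = (1 - ‖p‖ ^ 2) * (1 - ‖f ζ‖ ^ 2) := by
    intro ζ
    simp only [← normSq_eq_norm_sq, normSq_apply, sub_re, sub_im, mul_re, mul_im, conj_re,
      conj_im, one_re, one_im]
    ring
  have hf : ∀ ζ ∈ leftHalfPlane, 0 < 1 - ‖f ζ‖ ^ 2 := by
    intro ζ hζ
    nlinarith [norm_nonneg (f ζ), h.norm_lt ζ hζ]
  refine ⟨norm_one, fun ζ hζ => ?_, fun ζ hζ => ?_, fun ζ hζ => ?_, fun ζ hζ => ?_⟩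
  · have hd := h.hasDerivAt ζ hζ
    refine ((hd.sub_const p).div ((hd.const_mul (conj p)).const_sub 1) (h0 ζ hζ)).congr_deriv ?_
    congr 1
    have hcp : p * conj p = ((‖p‖ ^ 2 : ℝ) : ℂ) := by rw [mul_conj, normSq_eq_norm_sq]
    rw [ofReal_sub, ← hcp, ofReal_one]
    ring
  · rw [norm_div, div_lt_one (norm_pos_iff.2 (h0 ζ hζ))]
    refine lt_of_pow_lt_pow_left₀ 2 (norm_nonneg _) ?_
    have := mul_pos hpp (hf ζ hζ)
    rw [← hsq] at this
    linarith
  · rw [h.monodromy ζ hζ, one_mul, one_mul]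
  · have hG := norm_pos_iff.2 (h0 ζ hζ)
    have h1 := hf ζ hζ
    have h2 : 1 - ‖(f ζ - p) / (1 - conj p * f ζ)‖ ^ 2 =
        (1 - ‖p‖ ^ 2) * (1 - ‖f ζ‖ ^ 2) / ‖1 - conj p * f ζ‖ ^ 2 := by
      rw [← hsq, norm_div, div_pow, sub_div, div_self (by positivity)]
    rw [h.metric ζ hζ, h2, norm_div, norm_pow, norm_mul, norm_real, Real.norm_of_nonneg hpp.le]
    field_simp

/-- An elliptic development can be written `f = e^{θζ} h(e^ζ)` with `-1 < θ ≤ 0`, where `h` is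
holomorphic in the disk and vanishes at `0`. -/
lemma EllipticDevelopment.exists_normalized {ρ : ℂ → ℝ}
    {f₀ f₀' : ℂ → ℂ} {m₀ : ℂ} (h₀ : EllipticDevelopment ρ f₀ f₀' m₀) :
    ∃ (f f' : ℂ → ℂ) (m : ℂ) (θ : ℝ) (h : ℂ → ℂ), EllipticDevelopment ρ f f' m ∧
      -1 < θ ∧ DifferentiableOn ℂ h (ball 0 1) ∧ h 0 = 0 ∧
      ∀ ζ ∈ leftHalfPlane, f ζ = exp (θ * ζ) * h (exp ζ) := by
  obtain ⟨θ, hθ1, hθ0, hθ⟩ : ∃ θ : ℝ, -1 < θ ∧ θ ≤ 0 ∧ exp (2 * Real.pi * I * θ) = m₀ := by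
    have hpi := Real.pi_pos
    have harg : exp (arg m₀ * I) = m₀ := by
      have := norm_mul_exp_arg_mul_I m₀
      rwa [h₀.norm_m, ofReal_one, one_mul] at this
    have hpiC : (Real.pi : ℂ) ≠ 0 := by exact_mod_cast hpi.ne'
    rcases le_or_gt (arg m₀) 0 with hle | hgt
    · refine ⟨arg m₀ / (2 * Real.pi), ?_, ?_, ?_⟩
      · rw [lt_div_iff₀ (by positivity)]
        linarith [neg_pi_lt_arg m₀]
      · exact div_nonpos_of_nonpos_of_nonneg hle (by positivity)
      · conv_rhs => rw [← harg]
        congr 1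
        push_cast
        field_simp
    · refine ⟨arg m₀ / (2 * Real.pi) - 1, ?_, ?_, ?_⟩
      · have : 0 < arg m₀ / (2 * Real.pi) := by positivity
        linarith
      · have : arg m₀ / (2 * Real.pi) ≤ 1 := by
          rw [div_le_one (by positivity)]
          linarith [arg_le_pi m₀]
        linarith
      · conv_rhs => rw [← harg]
        have : 2 * Real.pi * I * ((arg m₀ / (2 * Real.pi) - 1 : ℝ) : ℂ) =
            arg m₀ * I - 2 * Real.pi * I := by
          push_cast
          field_simp
        rw [this, exp_sub, exp_two_pi_mul_I, div_one]
  have hbound : ∀ ζ ∈ leftHalfPlane, ‖exp (-(θ * ζ)) * f₀ ζ‖ ≤ Real.exp (-θ * ζ.re) := by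
    intro ζ hζ
    rw [norm_mul, norm_exp]
    have h1 : (-(θ * ζ) : ℂ).re = -θ * ζ.re := by simp
    rw [h1]
    exact mul_le_of_le_one_right (Real.exp_pos _).le (h₀.norm_lt ζ hζ).le
  have hd : DifferentiableOn ℂ (fun ζ => exp (-(θ * ζ)) * f₀ ζ) leftHalfPlane := fun ζ hζ =>
    (DifferentiableAt.mul (by fun_prop)
      (h₀.hasDerivAt ζ hζ).differentiableAt).differentiableWithinAt
  obtain ⟨h, hh, hhe⟩ := exists_descent (C := 1) hd (fun ζ hζ => by
      have h1 : -(θ * (ζ + 2 * Real.pi * I)) = -(θ * ζ) - 2 * Real.pi * I * θ := by ring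
      rw [h1, exp_sub, hθ, h₀.monodromy ζ hζ]
      have : m₀ ≠ 0 := by rw [← hθ]; exact exp_ne_zero _
      field_simp) (fun ζ hζ => by
      refine (hbound ζ hζ).trans (Real.exp_le_one_iff.2 ?_)
      have h1 : ζ.re < 0 := hζ
      nlinarith)
  have hform : ∀ ζ ∈ leftHalfPlane, f₀ ζ = exp (θ * ζ) * h (exp ζ) := by
    intro ζ hζ
    rw [hhe ζ hζ, ← mul_assoc, ← exp_add]
    simp
  have hcont : ContinuousAt h 0 :=
    (hh.differentiableAt (ball_mem_nhds _ one_pos)).continuousAt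
  have hmem : ∀ᶠ w in 𝓝[≠] (0 : ℂ), w ∈ puncturedDisk :=
    inter_mem (mem_nhdsWithin_of_mem_nhds (ball_mem_nhds _ one_pos)) self_mem_nhdsWithin
  rcases hθ0.lt_or_eq with hneg | hzero
  · -- `|h(w)| ≤ |w|^{-θ}` tends to `0`.
    refine ⟨f₀, f₀', m₀, θ, h, h₀, hθ1, hh, ?_, hform⟩
    have hlim : Tendsto (fun w : ℂ => ‖w‖ ^ (-θ)) (𝓝[≠] 0) (𝓝 0) := by
      have h1 : ContinuousAt (fun w : ℂ => ‖w‖ ^ (-θ)) 0 :=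
        continuous_norm.continuousAt.rpow_const (Or.inr (by linarith))
      have h2 := h1.tendsto
      simp only [norm_zero, Real.zero_rpow (by linarith : -θ ≠ 0)] at h2
      exact h2.mono_left nhdsWithin_le_nhds
    have hlim' : Tendsto h (𝓝[≠] 0) (𝓝 0) := by
      refine squeeze_zero_norm' ?_ hlim
      filter_upwards [hmem] with w hw
      obtain ⟨ζ, hζ, rfl⟩ := exists_log_mem hw
      rw [hhe ζ hζ, norm_exp, ← Real.exp_mul, mul_comm ζ.re]
      exact hbound ζ hζ
    exact tendsto_nhds_unique (hcont.tendsto.mono_left nhdsWithin_le_nhds) hlim'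
  · -- Trivial monodromy: `f` descends to the disk, and a disk automorphism normalises `f = 0` at
    -- the puncture.
    have hm : m₀ = 1 := by rw [← hθ, hzero]; simp
    subst hm
    have hle : ∀ w ∈ puncturedDisk, ‖h w‖ < 1 := by
      intro w hw
      obtain ⟨ζ, hζ, rfl⟩ := exists_log_mem hw
      have := h₀.norm_lt ζ hζ
      rw [hform ζ hζ, hzero] at this
      simpa using this
    have hp1 : ‖h 0‖ ≤ 1 :=
      le_of_tendsto (hcont.norm.tendsto.mono_left nhdsWithin_le_nhds)
        (hmem.mono fun w hw => (hle w hw).le)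
    have hp : ‖h 0‖ < 1 := by
      refine lt_of_le_of_ne hp1 fun heq => ?_
      have hmax : IsLocalMax (norm ∘ h) 0 := by
        filter_upwards [ball_mem_nhds (0 : ℂ) one_pos] with w hw
        simp only [Function.comp, heq]
        by_cases hw0 : w = 0
        · rw [hw0, heq]
        · exact (hle w ⟨hw, hw0⟩).le
      have hev : ∀ᶠ w in 𝓝 (0 : ℂ), DifferentiableAt ℂ h w := by
        filter_upwards [isOpen_ball.mem_nhds (mem_ball_self one_pos)] with w hw
        exact hh.differentiableAt (isOpen_ball.mem_nhds hw)
      have hconst := Complex.eventually_eq_of_isLocalMax_norm hev hmax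
      obtain ⟨w, hw1, hw2⟩ := ((hconst.filter_mono nhdsWithin_le_nhds).and hmem).exists
      have := hle w hw2
      rw [hw1, heq] at this
      exact lt_irrefl _ this
    have hcp : ∀ w ∈ ball (0 : ℂ) 1, 1 - conj (h 0) * h w ≠ 0 := by
      intro w hw h1
      have h2 : ‖conj (h 0) * h w‖ = 1 := by rw [← sub_eq_zero.1 h1, norm_one]
      rw [norm_mul, norm_conj] at h2
      have h3 : ‖h w‖ ≤ 1 := by
        by_cases hw0 : w = 0
        · rw [hw0]
          exact hp1
        · exact (hle w ⟨hw, hw0⟩).le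
      nlinarith [norm_nonneg (h 0), norm_nonneg (h w)]
    refine ⟨_, _, 1, 0, fun w => (h w - h 0) / (1 - conj (h 0) * h w), h₀.moebius hp, by norm_num,
      (hh.sub_const _).div ((hh.const_mul _).const_sub _) hcp, by simp, fun ζ hζ => ?_⟩
    have := hform ζ hζ
    rw [hzero] at this
    simp only [ofReal_zero, zero_mul, exp_zero, one_mul] at this ⊢
    rw [this]

/-- `f = e^{αζ} k(e^ζ)` with `k(0) ≠ 0` and `α > 0`, so that `z = w k(w)^{1/α}` satisfies
`f = z^α`. -/
lemma EllipticDevelopment.exists_conicalNormalCoordinate {ρ : ℂ → ℝ}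
    (hρ : ∀ w ∈ puncturedDisk, 0 < ρ w) {f₀ f₀' : ℂ → ℂ} {m₀ : ℂ}
    (h₀ : EllipticDevelopment ρ f₀ f₀' m₀) :
    ∃ (α ε : ℝ) (z : ℂ → ℂ), 0 < α ∧ IsConicalNormalCoordinate ρ α ε z := by
  obtain ⟨f, f', m, θ, h, hf, hθ, hh, hh0, hform⟩ := h₀.exists_normalized
  have hana : AnalyticAt ℂ h 0 := hh.analyticAt (ball_mem_nhds _ one_pos)
  have hne : ¬ ∀ᶠ w in 𝓝 (0 : ℂ), h w = 0 := by
    intro hev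
    have hmem : ∀ᶠ w in 𝓝[≠] (0 : ℂ), w ∈ puncturedDisk :=
      inter_mem (mem_nhdsWithin_of_mem_nhds (ball_mem_nhds _ one_pos)) self_mem_nhdsWithin
    obtain ⟨w, hw1, hw2⟩ :=
      ((hev.eventually_nhds.filter_mono nhdsWithin_le_nhds).and hmem).exists
    obtain ⟨ζ, hζ, rfl⟩ := exists_log_mem hw2
    refine hf.deriv_ne_zero hρ hζ ((hf.hasDerivAt ζ hζ).unique ?_)
    refine (hasDerivAt_const ζ (0 : ℂ)).congr_of_eventuallyEq ?_
    filter_upwards [isOpen_leftHalfPlane.mem_nhds hζ, continuous_exp.continuousAt.eventually hw1]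
      with ξ h1 h2
    rw [hform ξ h1, h2, mul_zero]
  obtain ⟨n, k, hk, hk0, hev⟩ := hana.exists_eventuallyEq_pow_smul_nonzero_iff.2 hne
  simp only [sub_zero, smul_eq_mul] at hev
  have hn : 1 ≤ n := by
    by_contra hn
    have := hev.self_of_nhds
    rw [hh0, show n = 0 by omega, pow_zero, one_mul] at this
    exact hk0 this.symm
  obtain ⟨l, hl, hlk⟩ := exists_local_log hk hk0
  set α : ℝ := n + θ with hα
  have hα0 : 0 < α := by
    have : (1 : ℝ) ≤ n := by exact_mod_cast hn
    linarith
  have hαC : (α : ℂ) ≠ 0 := by exact_mod_cast hα0.ne'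
  set z : ℂ → ℂ := fun w => w * exp (l w / α) with hz
  have hzan : AnalyticAt ℂ z 0 := analyticAt_id.mul ((hl.div_const).cexp)
  have hzd : HasDerivAt z (exp (l 0 / α)) 0 := by
    have h1 := (hl.differentiableAt.hasDerivAt.div_const (α : ℂ)).cexp
    exact ((hasDerivAt_id (0 : ℂ)).mul h1).congr_deriv (by simp)
  obtain ⟨ε, hε0, hε1, hc, hmet⟩ := exists_coordinate (ρ := ρ) (z := z)
    (N := fun ζ => ζ + l (exp ζ) / α) (N' := fun ζ => 1 + deriv l (exp ζ) * exp ζ / α)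
    (τ := fun w => 4 * α ^ 2 * ‖z w‖ ^ (2 * α - 2) / (1 - ‖z w‖ ^ (2 * α)) ^ 2) hzan (by simp [hz])
    (by rw [hzd.deriv]; exact exp_ne_zero _) (by
      filter_upwards [hev.eventually_nhds, hlk.eventually_nhds, hl.eventually_analyticAt,
        ball_mem_nhds (0 : ℂ) one_pos] with w h1 h2 h3 h4 ζ hζ
      subst hζ
      have hζ : ζ ∈ leftHalfPlane := mem_leftHalfPlane_of_exp h4
      have hN : HasDerivAt (fun ζ => ζ + l (exp ζ) / α) (1 + deriv l (exp ζ) * exp ζ / α) ζ :=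
        (hasDerivAt_id ζ).add
          ((HasDerivAt.comp ζ h3.differentiableAt.hasDerivAt (hasDerivAt_exp ζ)).div_const _)
      have hzN : z (exp ζ) = exp (ζ + l (exp ζ) / α) := by rw [exp_add]
      refine ⟨hN, hzN, ?_⟩
      have hfN : ∀ᶠ ξ in 𝓝 ζ, f ξ = exp (α * (ξ + l (exp ξ) / α)) := by
        filter_upwards [isOpen_leftHalfPlane.mem_nhds hζ,
          continuous_exp.continuousAt.eventually h1,
          continuous_exp.continuousAt.eventually h2] with ξ e1 e2 e3
        rw [hform ξ e1, e2, ← e3, mul_add, mul_div_cancel₀ _ hαC, exp_add, hα]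
        push_cast
        rw [add_mul, exp_add, exp_nat_mul]
        ring
      have hfd := (hf.hasDerivAt ζ hζ).unique
        (((hN.const_mul (α : ℂ)).cexp).congr_of_eventuallyEq hfN)
      have hfn : ‖f ζ‖ = ‖z (exp ζ)‖ ^ α := by
        rw [hfN.self_of_nhds, hzN, norm_exp, norm_exp, ← Real.exp_mul]
        congr 1
        simp
        ring
      have hzpos : 0 < ‖z (exp ζ)‖ := by rw [hzN]; exact norm_pos_iff.2 (exp_ne_zero _)
      rw [← hfN.self_of_nhds] at hfd
      rw [hf.metric ζ hζ, hfd, norm_mul, norm_mul, hfn, norm_real, Real.norm_of_nonneg hα0.le]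
      have e1 : ‖z (exp ζ)‖ ^ (2 * α) = (‖z (exp ζ)‖ ^ α) ^ 2 := by
        rw [mul_comm, Real.rpow_mul hzpos.le, Real.rpow_two]
      have e2 : ‖z (exp ζ)‖ ^ (2 * α - 2) * ‖z (exp ζ)‖ ^ 2 = (‖z (exp ζ)‖ ^ α) ^ 2 := by
        rw [Real.rpow_sub hzpos, e1, Real.rpow_two]
        field_simp
      rw [e1]
      calc 4 * (‖z (exp ζ)‖ ^ α * (α * ‖1 + deriv l (exp ζ) * exp ζ / α‖)) ^ 2 /
            (1 - (‖z (exp ζ)‖ ^ α) ^ 2) ^ 2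
          = 4 * α ^ 2 * (‖z (exp ζ)‖ ^ α) ^ 2 / (1 - (‖z (exp ζ)‖ ^ α) ^ 2) ^ 2 *
            ‖1 + deriv l (exp ζ) * exp ζ / α‖ ^ 2 := by ring
        _ = _ := by
          rw [← e2]
          ring)
  exact ⟨α, ε, z, hα0, hε0, hε1, hc, hmet⟩

/-! ### Parabolic and hyperbolic monodromy: cuspidal normal form -/

/-- The Cayley transform turns an affine development with trivial monodromy into a map to the
disk. -/
lemma AffineDevelopment.cayley {ρ : ℂ → ℝ} {F F' : ℂ → ℂ} (h : AffineDevelopment ρ F F' 1 0) :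
    EllipticDevelopment ρ (fun ζ => (F ζ - 1) / (F ζ + 1)) (fun ζ => 2 * F' ζ / (F ζ + 1) ^ 2) 1 := by
  have h0 : ∀ ζ ∈ leftHalfPlane, F ζ + 1 ≠ 0 := by
    intro ζ hζ h1
    have h2 := congrArg re h1
    have h3 := h.re_pos ζ hζ
    simp at h2
    linarith
  have hsq : ∀ ζ, ‖F ζ + 1‖ ^ 2 - ‖F ζ - 1‖ ^ 2 = 4 * (F ζ).re := by
    intro ζ
    simp only [← normSq_eq_norm_sq, normSq_apply, sub_re, sub_im, add_re, add_im, one_re, one_im]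
    ring
  refine ⟨norm_one, fun ζ hζ => ?_, fun ζ hζ => ?_, fun ζ hζ => ?_, fun ζ hζ => ?_⟩
  · have hd := h.hasDerivAt ζ hζ
    refine ((hd.sub_const 1).div (hd.add_const 1) (h0 ζ hζ)).congr_deriv ?_
    congr 1
    ring
  · rw [norm_div, div_lt_one (norm_pos_iff.2 (h0 ζ hζ))]
    refine lt_of_pow_lt_pow_left₀ 2 (norm_nonneg _) ?_
    have := h.re_pos ζ hζ
    linarith [hsq ζ]
  · rw [h.monodromy ζ hζ]
    simp
  · have hG := norm_pos_iff.2 (h0 ζ hζ)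
    have h1 := h.re_pos ζ hζ
    have h2 : 1 - ‖(F ζ - 1) / (F ζ + 1)‖ ^ 2 = 4 * (F ζ).re / ‖F ζ + 1‖ ^ 2 := by
      rw [← hsq, norm_div, div_pow, sub_div, div_self (by positivity)]
    rw [h.metric ζ hζ, h2, norm_div, norm_pow, norm_mul]
    simp only [Complex.norm_ofNat]
    field_simp
    norm_num

/-- For parabolic monodromy `F ↦ F + i b` the function `z = exp(-2π F / |b|)` descends to the disk.
It vanishes at the puncture to the order `|b| / |b| = 1`. -/
lemma AffineDevelopment.exists_cuspNormalCoordinate {ρ : ℂ → ℝ} {F F' : ℂ → ℂ} {b : ℝ}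
    (h : AffineDevelopment ρ F F' 1 b) (hb : b ≠ 0) :
    ∃ (ε : ℝ) (z : ℂ → ℂ), IsCuspNormalCoordinate ρ ε z := by
  set c : ℝ := 2 * Real.pi / |b| with hc
  have hc0 : 0 < c := by have := Real.pi_pos; have := abs_pos.2 hb; positivity
  have hcb : c * b = 2 * Real.pi ∨ c * b = -(2 * Real.pi) := by
    have hb' := abs_pos.2 hb
    rcases abs_cases b with ⟨h1, -⟩ | ⟨h1, -⟩
    · left
      rw [hc, h1, div_mul_cancel₀ _ hb]
    · right
      rw [hc, h1, div_neg, neg_mul, div_mul_cancel₀ _ hb]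
  have hNd : ∀ ζ ∈ leftHalfPlane, HasDerivAt (fun ζ => -(c * F ζ)) (-(c * F' ζ)) ζ := fun ζ hζ =>
    ((h.hasDerivAt ζ hζ).const_mul _).neg
  have hNt : ∀ ζ ∈ leftHalfPlane,
      -(c * F (ζ + 2 * Real.pi * I)) = -(c * F ζ) - (c * b : ℝ) * I := by
    intro ζ hζ
    rw [h.monodromy ζ hζ]
    push_cast
    ring
  obtain ⟨z, hz, hzN⟩ := exists_descent (G := fun ζ => exp (-(c * F ζ))) (C := 1)
    (fun ζ hζ => (hNd ζ hζ).cexp.differentiableAt.differentiableWithinAt) (fun ζ hζ => by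
      rw [hNt ζ hζ, exp_sub]
      have : exp ((c * b : ℝ) * I) = 1 := by
        rcases hcb with h1 | h1 <;> rw [h1] <;> push_cast
        · exact exp_two_pi_mul_I
        · rw [neg_mul, exp_neg, exp_two_pi_mul_I, inv_one]
      rw [this, div_one]) (fun ζ hζ => by
      rw [norm_exp, Real.exp_le_one_iff]
      have := h.re_pos ζ hζ
      have h1 : (-(c * F ζ) : ℂ).re = -(c * (F ζ).re) := by simp
      rw [h1]
      have := mul_pos hc0 this
      linarith)
  obtain ⟨n, k, hk, hk0, hev, ζ₀, hζ₀, hn⟩ := order_eq_monodromy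
    (hz.analyticAt (ball_mem_nhds _ one_pos))
    (fun ζ hζ => (hNd ζ hζ).differentiableAt.differentiableWithinAt) (fun ζ hζ => (hzN ζ hζ).symm)
  have hn1 : n = 1 := by
    rw [hNt ζ₀ hζ₀] at hn
    have h1 := congrArg im hn
    simp only [sub_im, add_im, mul_im, ofReal_re, ofReal_im, I_re, I_im, natCast_re, natCast_im,
      mul_re, re_ofNat, im_ofNat] at h1
    have h2 : -(c * b) = n * (2 * Real.pi) := by linarith
    have hpi := Real.pi_pos
    rcases hcb with h3 | h3 <;> rw [h3] at h2
    · have : (0 : ℝ) ≤ n * (2 * Real.pi) := by positivity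
      linarith
    · have h4 : (n : ℝ) = 1 := by
        have : (2 * Real.pi) * ((n : ℝ) - 1) = 0 := by linarith
        rcases mul_eq_zero.1 this with h5 | h5 <;> linarith
      exact_mod_cast h4
  subst hn1
  simp only [pow_one] at hev
  have hz0 : z 0 = 0 := by simpa using hev.self_of_nhds
  have hzd : HasDerivAt z (k 0) 0 := by
    refine (((hasDerivAt_id (0 : ℂ)).mul hk.differentiableAt.hasDerivAt).congr_deriv
      (by simp)).congr_of_eventuallyEq ?_
    filter_upwards [hev] with w hw using by simpa using hw
  obtain ⟨ε, hε0, hε1, hcc, hmet⟩ := exists_coordinate (ρ := ρ) (z := z)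
    (N := fun ζ => -(c * F ζ)) (N' := fun ζ => -(c * F' ζ))
    (τ := fun w => (‖z w‖ ^ 2)⁻¹ * (Real.log ‖z w‖ ^ 2)⁻¹)
    (hz.analyticAt (ball_mem_nhds _ one_pos)) hz0 (by rw [hzd.deriv]; exact hk0) (by
      filter_upwards [ball_mem_nhds (0 : ℂ) one_pos] with w hw ζ hζ
      subst hζ
      have hζ : ζ ∈ leftHalfPlane := mem_leftHalfPlane_of_exp hw
      have hzpos : 0 < ‖z (exp ζ)‖ := by rw [hzN ζ hζ]; exact norm_pos_iff.2 (exp_ne_zero _)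
      refine ⟨hNd ζ hζ, hzN ζ hζ, ?_⟩
      have hlog : Real.log ‖z (exp ζ)‖ = -(c * (F ζ).re) := by
        rw [hzN ζ hζ, norm_exp, Real.log_exp]
        simp
      have hre := h.re_pos ζ hζ
      rw [h.metric ζ hζ, hlog, norm_neg, norm_mul, norm_real, Real.norm_of_nonneg hc0.le]
      field_simp)
  exact ⟨ε, z, hε0, hε1, hcc, hmet⟩

/-- Hyperbolic monodromy `F ↦ k F + i b`, `k ≠ 1`, is impossible.  After moving the fixed point to
`0` one has `F ↦ k F`, and `exp(2πi log F / log k)` descends to a holomorphic function bounded away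
from `0`, whose logarithm nevertheless has monodromy `2πi`. -/
lemma AffineDevelopment.k_eq_one {ρ : ℂ → ℝ} {F F' : ℂ → ℂ} {k b : ℝ}
    (h : AffineDevelopment ρ F F' k b) : k = 1 := by
  by_contra hk
  have hlk : Real.log k ≠ 0 := by
    intro h0
    rcases Real.log_eq_zero.1 h0 with h1 | h1 | h1
    · exact h.k_pos.ne' h1
    · exact hk h1
    · linarith [h.k_pos]
  have hlkC : (Real.log k : ℂ) ≠ 0 := by exact_mod_cast hlk
  have hk1 : (k : ℂ) - 1 ≠ 0 := by
    rw [sub_ne_zero]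
    exact_mod_cast hk
  set d : ℝ := b / (k - 1) with hd
  have hd' : (k : ℂ) * d = d + b := by
    rw [hd]
    push_cast
    field_simp
    ring
  set F₁ : ℂ → ℂ := fun ζ => F ζ + d * I with hF₁
  have hre : ∀ ζ ∈ leftHalfPlane, 0 < (F₁ ζ).re := by
    intro ζ hζ
    simpa [hF₁] using h.re_pos ζ hζ
  have hne : ∀ ζ ∈ leftHalfPlane, F₁ ζ ≠ 0 := by
    intro ζ hζ h0
    have := hre ζ hζ
    rw [h0] at this
    simp at this
  have hmon : ∀ ζ ∈ leftHalfPlane, F₁ (ζ + 2 * Real.pi * I) = k * F₁ ζ := by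
    intro ζ hζ
    simp only [hF₁]
    rw [h.monodromy ζ hζ]
    linear_combination (-I) * hd'
  set N : ℂ → ℂ := fun ζ => 2 * Real.pi * I * (log (F₁ ζ) / Real.log k) with hN
  have hNd : DifferentiableOn ℂ N leftHalfPlane := by
    intro ζ hζ
    have h1 : DifferentiableAt ℂ F₁ ζ := (h.hasDerivAt ζ hζ).differentiableAt.add_const _
    have h2 : DifferentiableAt ℂ (fun ζ => log (F₁ ζ)) ζ := h1.clog (Or.inl (hre ζ hζ))
    exact ((h2.div_const _).const_mul _).differentiableWithinAt
  have hNt : ∀ ζ ∈ leftHalfPlane, N (ζ + 2 * Real.pi * I) = N ζ + 2 * Real.pi * I := by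
    intro ζ hζ
    simp only [hN]
    rw [hmon ζ hζ, log_ofReal_mul h.k_pos (hne ζ hζ)]
    field_simp
    ring
  have hnorm : ∀ ζ, ‖exp (N ζ)‖ = Real.exp (-(2 * Real.pi * (arg (F₁ ζ) / Real.log k))) := by
    intro ζ
    rw [norm_exp]
    congr 1
    simp only [hN]
    rw [show 2 * Real.pi * I * (log (F₁ ζ) / Real.log k) =
      ((2 * Real.pi / Real.log k : ℝ) : ℂ) * (I * log (F₁ ζ)) by push_cast; ring, re_ofReal_mul,
      I_mul_re, log_im]
    ring
  set B : ℝ := 2 * Real.pi * (Real.pi / |Real.log k|) with hB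
  have hab : ∀ ζ, |2 * Real.pi * (arg (F₁ ζ) / Real.log k)| ≤ B := by
    intro ζ
    have hpi := Real.pi_pos
    rw [abs_mul, abs_div, abs_of_pos (by positivity : 0 < 2 * Real.pi), hB]
    gcongr
    exact abs_arg_le_pi _
  obtain ⟨g, hg, hgN⟩ := exists_descent (G := fun ζ => exp (N ζ)) (C := Real.exp B) hNd.cexp
    (fun ζ hζ => by
      rw [hNt ζ hζ, exp_add_two_pi_I]) (fun ζ hζ => by
      rw [hnorm]
      exact Real.exp_le_exp.2 (by linarith [(abs_le.1 (hab ζ)).1]))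
  have hgcont : ContinuousAt g 0 :=
    (hg.differentiableAt (ball_mem_nhds _ one_pos)).continuousAt
  have hg0 : Real.exp (-B) ≤ ‖g 0‖ := by
    have ht : Tendsto (fun w => ‖g w‖) (𝓝[≠] 0) (𝓝 ‖g 0‖) :=
      hgcont.norm.tendsto.mono_left nhdsWithin_le_nhds
    refine ge_of_tendsto ht ?_
    have hmem : ∀ᶠ w in 𝓝[≠] (0 : ℂ), w ∈ puncturedDisk :=
      inter_mem (mem_nhdsWithin_of_mem_nhds (ball_mem_nhds _ one_pos)) self_mem_nhdsWithin
    filter_upwards [hmem] with w hw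
    obtain ⟨ζ, hζ, rfl⟩ := exists_log_mem hw
    rw [hgN ζ hζ, hnorm]
    exact Real.exp_le_exp.2 (by linarith [(abs_le.1 (hab ζ)).2])
  obtain ⟨n, q, -, -, hev, ζ₀, hζ₀, hn⟩ := order_eq_monodromy
    (hg.analyticAt (ball_mem_nhds _ one_pos)) hNd (fun ζ hζ => (hgN ζ hζ).symm)
  have hn0 : n ≠ 0 := by
    rintro rfl
    rw [hNt ζ₀ hζ₀] at hn
    refine two_pi_I_ne_zero ?_
    linear_combination hn
  have := hev.self_of_nhds
  rw [zero_pow hn0, zero_mul] at this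
  rw [this, norm_zero] at hg0
  linarith [Real.exp_pos (-B)]

/-- Every hyperbolic metric on the punctured disk has a conical or a cuspidal normal form. -/
lemma IsConformalHyperbolicMetric.exists_normalCoordinate {ρ : ℂ → ℝ}
    (hρ : IsConformalHyperbolicMetric ρ puncturedDisk) :
    (∃ (α ε : ℝ) (z : ℂ → ℂ), 0 < α ∧ IsConicalNormalCoordinate ρ α ε z) ∨
      ∃ (ε : ℝ) (z : ℂ → ℂ), IsCuspNormalCoordinate ρ ε z := by
  rcases hρ.elliptic_or_affine with ⟨f, f', m, h⟩ | ⟨F, F', k, b, h⟩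
  · exact Or.inl (h.exists_conicalNormalCoordinate hρ.pos)
  · obtain rfl := h.k_eq_one
    by_cases hb : b = 0
    · subst hb
      exact Or.inl (h.cayley.exists_conicalNormalCoordinate hρ.pos)
    · exact Or.inr (h.exists_cuspNormalCoordinate hb)

/-! ### Growth of the metric at the puncture -/

lemma IsCenteredCoordinate.analyticAt {z : ℂ → ℂ} {U : Set ℂ} (hz : IsCenteredCoordinate z U) :
    AnalyticAt ℂ z 0 :=
  hz.holomorphic.analyticAt (hz.isOpen.mem_nhds hz.zero_mem)

lemma IsCenteredCoordinate.ne_zero {z : ℂ → ℂ} {U : Set ℂ} (hz : IsCenteredCoordinate z U)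
    {w : ℂ} (hw : w ∈ U) (h0 : w ≠ 0) : z w ≠ 0 := fun h =>
  h0 (hz.injective hw hz.zero_mem (h.trans hz.map_zero.symm))

/-- An injective holomorphic function has nonzero derivative: near a zero of order `n` it is the
`n`-th power of a local homeomorphism, and `n`-th powers identify the `n`-th roots of unity. -/
lemma IsCenteredCoordinate.deriv_ne_zero {z : ℂ → ℂ} {U : Set ℂ}
    (hz : IsCenteredCoordinate z U) : deriv z 0 ≠ 0 := by
  have hU : U ∈ 𝓝 (0 : ℂ) := hz.isOpen.mem_nhds hz.zero_mem
  have hne : ¬ ∀ᶠ w in 𝓝 (0 : ℂ), z w = 0 := by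
    intro hev
    obtain ⟨w, ⟨h1, h2⟩, h3⟩ := (((hev.and hU).filter_mono nhdsWithin_le_nhds).and
      (self_mem_nhdsWithin : {(0 : ℂ)}ᶜ ∈ 𝓝[≠] 0)).exists
    exact hz.ne_zero h2 h3 h1
  obtain ⟨n, k, hk, hk0, hev⟩ := hz.analyticAt.exists_eventuallyEq_pow_smul_nonzero_iff.2 hne
  simp only [sub_zero, smul_eq_mul] at hev
  have hn0 : n ≠ 0 := by
    rintro rfl
    have := hev.self_of_nhds
    rw [hz.map_zero, pow_zero, one_mul] at this
    exact hk0 this.symm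
  by_cases hn1 : n = 1
  · subst hn1
    have hd : HasDerivAt z (k 0) 0 := by
      refine (((hasDerivAt_id (0 : ℂ)).mul hk.differentiableAt.hasDerivAt).congr_deriv
        (by simp)).congr_of_eventuallyEq ?_
      filter_upwards [hev] with w hw using by simpa using hw
    rwa [hd.deriv]
  exfalso
  obtain ⟨l, hl, hlk⟩ := exists_local_log hk hk0
  have hnC : (n : ℂ) ≠ 0 := by exact_mod_cast hn0
  set φ : ℂ → ℂ := fun w => w * exp (l w / n) with hφ
  have hφa : AnalyticAt ℂ φ 0 := analyticAt_id.mul ((hl.div_const).cexp)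
  have hφd : HasDerivAt φ (exp (l 0 / n)) 0 :=
    ((hasDerivAt_id (0 : ℂ)).mul
      (hl.differentiableAt.hasDerivAt.div_const (n : ℂ)).cexp).congr_deriv (by simp)
  have hφs : HasStrictDerivAt φ (exp (l 0 / n)) 0 := by
    rw [← hφd.deriv]
    exact hφa.hasStrictDerivAt
  have hmap := hφs.map_nhds_eq (exp_ne_zero _)
  have hφ0 : φ 0 = 0 := by simp [hφ]
  rw [hφ0] at hmap
  have hV : {w | w ∈ U ∧ z w = φ w ^ n} ∈ 𝓝 (0 : ℂ) := by
    filter_upwards [hU, hev, hlk] with w h1 h2 h3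
    refine ⟨h1, ?_⟩
    rw [h2, ← h3, hφ, mul_pow, ← exp_nat_mul, mul_div_cancel₀ _ hnC]
  have himg := image_mem_map (m := φ) hV
  rw [hmap] at himg
  obtain ⟨δ, hδ, hb⟩ := Metric.mem_nhds_iff.1 himg
  set t : ℂ := ((δ / 2 : ℝ) : ℂ) with ht
  have htn : ‖t‖ = δ / 2 := by rw [ht, norm_real, Real.norm_of_nonneg (by positivity)]
  have hη := Complex.isPrimitiveRoot_exp n hn0
  set η := exp (2 * Real.pi * I / n) with hηd
  have hηn : ‖η‖ = 1 := hη.norm'_eq_one hn0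
  obtain ⟨a, ⟨ha1, ha2⟩, ha⟩ := hb (show t ∈ ball 0 δ by rw [mem_ball_zero_iff, htn]; linarith)
  obtain ⟨c, ⟨hc1, hc2⟩, hc⟩ := hb (show η * t ∈ ball 0 δ by
    rw [mem_ball_zero_iff, norm_mul, hηn, one_mul, htn]; linarith)
  have hac : a = c := hz.injective ha1 hc1 (by
    rw [ha2, hc2, ha, hc, mul_pow, hη.pow_eq_one, one_mul])
  rw [← hac, ha] at hc
  have ht0 : t ≠ 0 := by rw [← norm_pos_iff, htn]; positivity
  have : η = 1 := mul_right_cancel₀ ht0 (by rw [one_mul, ← hc])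
  exact hη.ne_one (by omega) this

lemma tendsto_log_norm : Tendsto (fun w : ℂ => Real.log ‖w‖) (𝓝[≠] 0) atBot :=
  Real.tendsto_log_nhdsGT_zero.comp tendsto_norm_nhdsNE_zero

lemma IsCenteredCoordinate.tendsto_log_sub {z : ℂ → ℂ} {U : Set ℂ}
    (hz : IsCenteredCoordinate z U) :
    Tendsto (fun w => Real.log ‖z w‖ - Real.log ‖w‖) (𝓝[≠] 0) (𝓝 (Real.log ‖deriv z 0‖)) := by
  have h1 := hz.analyticAt.differentiableAt.hasDerivAt.tendsto_slope_zero
  have h2 := (h1.norm).log (norm_ne_zero_iff.2 hz.deriv_ne_zero)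
  refine h2.congr' ?_
  have hU : ∀ᶠ w in 𝓝[≠] (0 : ℂ), w ∈ U :=
    mem_nhdsWithin_of_mem_nhds (hz.isOpen.mem_nhds hz.zero_mem)
  filter_upwards [hU, self_mem_nhdsWithin] with w hw h0
  rw [zero_add, hz.map_zero, sub_zero, norm_smul, norm_inv,
    Real.log_mul (inv_ne_zero (norm_ne_zero_iff.2 h0)) (norm_ne_zero_iff.2 (hz.ne_zero hw h0)),
    Real.log_inv]
  ring

lemma IsCenteredCoordinate.tendsto_log_deriv {z : ℂ → ℂ} {U : Set ℂ}
    (hz : IsCenteredCoordinate z U) :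
    Tendsto (fun w => Real.log ‖deriv z w‖) (𝓝[≠] 0) (𝓝 (Real.log ‖deriv z 0‖)) :=
  ((hz.analyticAt.deriv.continuousAt.norm).log
    (norm_ne_zero_iff.2 hz.deriv_ne_zero)).tendsto.mono_left nhdsWithin_le_nhds

lemma IsCenteredCoordinate.tendsto_log_div {z : ℂ → ℂ} {U : Set ℂ}
    (hz : IsCenteredCoordinate z U) :
    Tendsto (fun w => Real.log ‖z w‖ / Real.log ‖w‖) (𝓝[≠] 0) (𝓝 1) := by
  have h1 := (hz.tendsto_log_sub.div_atBot tendsto_log_norm).add_const 1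
  rw [zero_add] at h1
  refine h1.congr' ?_
  filter_upwards [tendsto_log_norm.eventually_lt_atBot 0] with w hw
  rw [sub_div, div_self hw.ne]
  ring

lemma log_metric_eq {ρ : ℂ → ℝ} {z : ℂ → ℂ} {u : ℂ → ℝ} {U : Set ℂ}
    (hz : IsCenteredCoordinate z U)
    (hm : MetricEqInCoordinate ρ U z fun w => Real.exp (2 * u w)) :
    ∀ᶠ w in 𝓝[≠] (0 : ℂ), w ∈ U \ {0} ∧
      Real.log (ρ w) = 2 * u w + 2 * Real.log ‖deriv z w‖ := by
  have hU : ∀ᶠ w in 𝓝[≠] (0 : ℂ), w ∈ U :=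
    mem_nhdsWithin_of_mem_nhds (hz.isOpen.mem_nhds hz.zero_mem)
  have hd : ∀ᶠ w in 𝓝[≠] (0 : ℂ), deriv z w ≠ 0 :=
    (hz.analyticAt.deriv.continuousAt.eventually_ne hz.deriv_ne_zero).filter_mono
      nhdsWithin_le_nhds
  filter_upwards [hU, hd, self_mem_nhdsWithin] with w h1 h2 h3
  refine ⟨⟨h1, h3⟩, ?_⟩
  rw [hm w ⟨h1, h3⟩, Real.log_mul (Real.exp_pos _).ne'
    (pow_ne_zero 2 (norm_ne_zero_iff.2 h2)), Real.log_exp, Real.log_pow]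
  norm_num

lemma tendsto_of_continuousOn {g : ℂ → ℝ} {U : Set ℂ} (hU : IsOpen U) (h0 : (0 : ℂ) ∈ U)
    (hg : ContinuousOn g U) : Tendsto g (𝓝[≠] 0) (𝓝 (g 0)) :=
  (hg.continuousAt (hU.mem_nhds h0)).tendsto.mono_left nhdsWithin_le_nhds

/-- The growth exponent of the metric at a conical singularity determines the cone angle. -/
lemma HasConicalSingularity.tendsto {ρ : ℂ → ℝ} {α : ℝ} (h : HasConicalSingularity ρ α) :
    Tendsto (fun w => Real.log (ρ w) / Real.log ‖w‖) (𝓝[≠] 0) (𝓝 (2 * α - 2)) := by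
  obtain ⟨-, U, z, u, -, hz, hm, g, hg, hgu⟩ := h
  have h1 := tendsto_of_continuousOn hz.isOpen hz.zero_mem hg
  have h2 := ((h1.const_mul 2).add (hz.tendsto_log_deriv.const_mul 2)).div_atBot tendsto_log_norm
  have h3 := h2.add (hz.tendsto_log_div.const_mul (2 * α - 2))
  rw [zero_add, mul_one] at h3
  refine h3.congr' ?_
  filter_upwards [log_metric_eq hz hm] with w ⟨hw, hlog⟩
  have h4 := hgu hw
  simp only at h4
  rw [hlog, h4]
  ring

/-- A cusp is the limiting case `α = 0` of the growth exponents at conical singularities. -/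
lemma HasCuspSingularity.tendsto {ρ : ℂ → ℝ} (h : HasCuspSingularity ρ) :
    Tendsto (fun w => Real.log (ρ w) / Real.log ‖w‖) (𝓝[≠] 0) (𝓝 (-2)) := by
  obtain ⟨U, z, u, -, hz, -, hm, g, hg, hgu⟩ := h
  have h1 := tendsto_of_continuousOn hz.isOpen hz.zero_mem hg
  have h2 := ((h1.const_mul 2).add (hz.tendsto_log_deriv.const_mul 2)).div_atBot tendsto_log_norm
  have hbot : Tendsto (fun w => -Real.log ‖z w‖) (𝓝[≠] 0) atTop := by
    refine tendsto_neg_atBot_atTop.comp ?_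
    refine (tendsto_log_norm.atBot_add hz.tendsto_log_sub).congr fun w => ?_
    ring
  have h5 : Tendsto (fun x : ℝ => Real.log x / x) atTop (𝓝 0) :=
    Real.isLittleO_log_id_atTop.tendsto_div_nhds_zero
  have h6 := (h5.comp hbot).mul hz.tendsto_log_div
  have h3 := (h2.add (hz.tendsto_log_div.const_mul (-2))).add (h6.const_mul 2)
  simp only [mul_one, zero_add, mul_zero, add_zero] at h3
  refine h3.congr' ?_
  filter_upwards [log_metric_eq hz hm, hbot.eventually_gt_atTop 0] with w ⟨hw, hlog⟩ hpos
  have h4 := hgu hw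
  simp only at h4
  have hne : Real.log ‖z w‖ ≠ 0 := by
    intro h0
    rw [h0] at hpos
    simp at hpos
  have h7 : Real.log (-Real.log ‖z w‖) / -Real.log ‖z w‖ * (Real.log ‖z w‖ / Real.log ‖w‖) =
      -Real.log (-Real.log ‖z w‖) / Real.log ‖w‖ := by
    field_simp
  simp only [Function.comp]
  rw [hlog, h4, h7]
  ring

/-! ### Uniqueness of rotationally symmetric coordinates -/

/-- At a boundary point of a disk where `|q|` is maximal, `w q'(w) / q(w)` is real and nonnegative:
`|q|` is stationary along the circle and does not decrease in the outward direction. -/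
lemma exists_nonneg_logDeriv_of_isMaxOn {q : ℂ → ℂ} {r : ℝ} {w : ℂ} (hw : ‖w‖ = r)
    (hq : DifferentiableAt ℂ q w) (hq0 : q w ≠ 0)
    (hmax : IsMaxOn (fun x => ‖q x‖) (closedBall 0 r) w) :
    ∃ s : ℝ, 0 ≤ s ∧ w * deriv q w = s * q w := by
  set P := conj (q w) * (w * deriv q w) with hP
  have key : ∀ e : ℂ, e.re ≤ 0 → (P * e).re ≤ 0 := by
    intro e he
    have d1 : HasDerivAt (fun t : ℝ => w * exp (t * e)) (w * e) 0 := by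
      have h1 : HasDerivAt (fun t : ℂ => w * exp (t * e)) (w * e) ((0 : ℝ) : ℂ) := by
        refine ((((hasDerivAt_id ((0 : ℝ) : ℂ)).mul_const e).cexp).const_mul w).congr_deriv ?_
        simp
      exact h1.comp_ofReal
    have e0 : w * exp (((0 : ℝ) : ℂ) * e) = w := by simp
    have d2 : HasDerivAt (fun t : ℝ => q (w * exp (t * e))) (deriv q w * (w * e)) 0 := by
      have hq' : HasDerivAt q (deriv q w) (w * exp (((0 : ℝ) : ℂ) * e)) := by
        rw [e0]
        exact hq.hasDerivAt
      exact HasDerivAt.comp (0 : ℝ) hq' d1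
    have d3 := d2.norm_sq
    rw [e0] at d3
    have d4 := d3.hasDerivWithinAt (s := Ioi 0)
    rw [hasDerivWithinAt_iff_tendsto_slope' (by simp)] at d4
    have h5 := le_of_tendsto d4 (b := 0) (by
      filter_upwards [self_mem_nhdsWithin] with t ht
      have ht0 : 0 < t := ht
      rw [slope_def_field, e0, sub_zero]
      refine div_nonpos_of_nonpos_of_nonneg ?_ ht0.le
      rw [sub_nonpos]
      have hm : w * exp (t * e) ∈ closedBall (0 : ℂ) r := by
        rw [mem_closedBall_zero_iff, norm_mul, hw, norm_exp, re_ofReal_mul]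
        refine mul_le_of_le_one_right (hw ▸ norm_nonneg w) (Real.exp_le_one_iff.2 ?_)
        exact mul_nonpos_of_nonneg_of_nonpos ht0.le he
      have := hmax hm
      simp only [mem_ofPred_eq] at this
      gcongr)
    rw [Complex.inner] at h5
    have h6 : P * e = deriv q w * (w * e) * conj (q w) := by rw [hP]; ring
    rw [h6]
    linarith
  have k1 := key I (by simp)
  have k2 := key (-I) (by simp)
  have k3 := key (-1) (by simp)
  simp at k1 k2 k3
  have him : P.im = 0 := le_antisymm k2 k1
  have hn : 0 < ‖q w‖ ^ 2 := by have := norm_pos_iff.2 hq0; positivity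
  refine ⟨P.re / ‖q w‖ ^ 2, div_nonneg k3 hn.le, ?_⟩
  have hPre : (P.re : ℂ) = P := by apply Complex.ext <;> simp [him]
  have hnC : ((‖q w‖ ^ 2 : ℝ) : ℂ) = q w * conj (q w) := by rw [mul_conj, normSq_eq_norm_sq]
  have hc0 : conj (q w) ≠ 0 := by rwa [Ne, map_eq_zero]
  rw [ofReal_div, hnC, hPre, hP]
  field_simp

/-- The rotationally symmetric metric `(φ(|z|) / |z|)² |dz|²`, with `φ` increasing, can be pulled back
to the same metric by two coordinates `z₁`, `z₂` only if `|z₂| ≤ |z₁|` near `0`.  At a maximum of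
`|z₂ / z₁|` over a small closed disk one has `|w z₂'/z₂| ≥ |w z₁'/z₁|`, and therefore
`φ(|z₂|) ≤ φ(|z₁|)`. -/
lemma eventually_norm_le_of_radial {φ : ℝ → ℝ} (hφ : StrictMonoOn φ (Ioo 0 1))
    (hφ0 : ∀ t ∈ Ioo (0 : ℝ) 1, 0 < φ t) {ε : ℝ} (hε : 0 < ε) {z₁ z₂ : ℂ → ℂ}
    (h₁ : IsCenteredCoordinate z₁ (ball 0 ε)) (h₂ : IsCenteredCoordinate z₂ (ball 0 ε))
    (hn₁ : ∀ w ∈ ball (0 : ℂ) ε, ‖z₁ w‖ < 1) (hn₂ : ∀ w ∈ ball (0 : ℂ) ε, ‖z₂ w‖ < 1)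
    (heq : ∀ w ∈ ball (0 : ℂ) ε \ {0},
      φ ‖z₁ w‖ / ‖z₁ w‖ * ‖deriv z₁ w‖ = φ ‖z₂ w‖ / ‖z₂ w‖ * ‖deriv z₂ w‖) :
    ∀ᶠ w in 𝓝 (0 : ℂ), ‖z₂ w‖ ≤ ‖z₁ w‖ := by
  have hball : ball (0 : ℂ) ε ∈ 𝓝 (0 : ℂ) := ball_mem_nhds _ hε
  set k₁ := dslope z₁ 0 with hk₁
  set k₂ := dslope z₂ 0 with hk₂
  have hkd₁ : DifferentiableOn ℂ k₁ (ball 0 ε) :=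
    (Complex.differentiableOn_dslope hball).2 h₁.holomorphic
  have hkd₂ : DifferentiableOn ℂ k₂ (ball 0 ε) :=
    (Complex.differentiableOn_dslope hball).2 h₂.holomorphic
  have hzk₁ : ∀ w, z₁ w = w * k₁ w := fun w => by
    have := sub_smul_dslope z₁ 0 w
    rw [h₁.map_zero, sub_zero, sub_zero, smul_eq_mul] at this
    exact this.symm
  have hzk₂ : ∀ w, z₂ w = w * k₂ w := fun w => by
    have := sub_smul_dslope z₂ 0 w
    rw [h₂.map_zero, sub_zero, sub_zero, smul_eq_mul] at this
    exact this.symm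
  have hne₁ : ∀ w ∈ ball (0 : ℂ) ε, k₁ w ≠ 0 := by
    intro w hw h
    by_cases hw0 : w = 0
    · rw [hw0, hk₁, dslope_same] at h
      exact h₁.deriv_ne_zero h
    · exact h₁.ne_zero hw hw0 (by rw [hzk₁, h, mul_zero])
  have hne₂ : ∀ w ∈ ball (0 : ℂ) ε, k₂ w ≠ 0 := by
    intro w hw h
    by_cases hw0 : w = 0
    · rw [hw0, hk₂, dslope_same] at h
      exact h₂.deriv_ne_zero h
    · exact h₂.ne_zero hw hw0 (by rw [hzk₂, h, mul_zero])
  set q : ℂ → ℂ := fun w => k₂ w / k₁ w with hq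
  have hqd : DifferentiableOn ℂ q (ball 0 ε) := hkd₂.div hkd₁ hne₁
  have hzq : ∀ w ∈ ball (0 : ℂ) ε, z₂ w = z₁ w * q w := by
    intro w hw
    have := hne₁ w hw
    rw [hzk₁, hzk₂, hq]
    field_simp
  have hA : ∀ᶠ w in 𝓝 (0 : ℂ), 0 < (deriv z₁ w / k₁ w).re := by
    have hc : ContinuousAt (fun w => (deriv z₁ w / k₁ w).re) 0 :=
      continuous_re.continuousAt.comp (h₁.analyticAt.deriv.continuousAt.div
        (hkd₁.continuousOn.continuousAt hball) (hne₁ 0 (mem_ball_self hε)))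
    refine hc.eventually (lt_mem_nhds ?_)
    beta_reduce
    rw [hk₁, dslope_same, div_self h₁.deriv_ne_zero]
    exact one_pos
  obtain ⟨δ, hδ, hδb⟩ := Metric.eventually_nhds_iff_ball.1 hA
  set r := min δ ε / 2 with hr
  have hr0 : 0 < r := by have := lt_min hδ hε; positivity
  have hrδ : r < δ := by have := min_le_left δ ε; linarith
  have hrε : r < ε := by have := min_le_right δ ε; linarith
  have hsub : closedBall (0 : ℂ) r ⊆ ball 0 ε := closedBall_subset_ball hrε
  have hdc : DiffContOnCl ℂ q (ball 0 r) :=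
    DifferentiableOn.diffContOnCl ((hqd.mono hsub).mono closure_ball_subset_closedBall)
  obtain ⟨w, hwf, hwmax⟩ := Complex.exists_mem_frontier_isMaxOn_norm isBounded_ball
    ⟨0, mem_ball_self hr0⟩ hdc
  rw [frontier_ball _ hr0.ne', mem_sphere_zero_iff_norm] at hwf
  rw [closure_ball _ hr0.ne'] at hwmax
  have hwc : w ∈ closedBall (0 : ℂ) r := by rw [mem_closedBall_zero_iff, hwf]
  have hwε : w ∈ ball (0 : ℂ) ε := hsub hwc
  have hw0 : w ≠ 0 := by rw [← norm_pos_iff, hwf]; exact hr0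
  have hqw : q w ≠ 0 := div_ne_zero (hne₂ w hwε) (hne₁ w hwε)
  have hqdw : DifferentiableAt ℂ q w := hqd.differentiableAt (isOpen_ball.mem_nhds hwε)
  obtain ⟨s, hs0, hs⟩ := exists_nonneg_logDeriv_of_isMaxOn hwf hqdw hqw hwmax
  have hz₁w : z₁ w ≠ 0 := h₁.ne_zero hwε hw0
  have hz₂w : z₂ w ≠ 0 := h₂.ne_zero hwε hw0
  have hd₂ : deriv z₂ w = deriv z₁ w * q w + z₁ w * deriv q w := by
    have h3 : HasDerivAt (fun x => z₁ x * q x) (deriv z₁ w * q w + z₁ w * deriv q w) w :=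
      (h₁.holomorphic.differentiableAt (isOpen_ball.mem_nhds hwε)).hasDerivAt.mul
        hqdw.hasDerivAt
    refine (h3.congr_of_eventuallyEq ?_).deriv
    filter_upwards [isOpen_ball.mem_nhds hwε] with x hx using hzq x hx
  have hApos : 0 < (w * deriv z₁ w / z₁ w).re := by
    have : w * deriv z₁ w / z₁ w = deriv z₁ w / k₁ w := by
      rw [hzk₁, mul_div_mul_left _ _ hw0]
    rw [this]
    exact hδb w (by rw [mem_ball_zero_iff, hwf]; exact hrδ)
  set A := w * deriv z₁ w / z₁ w with hAdef
  have hlog₂ : w * deriv z₂ w / z₂ w = A + s := by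
    rw [hd₂, hzq w hwε, hAdef]
    field_simp
    linear_combination (z₁ w) * hs
  have hnorm : ‖A‖ ≤ ‖A + s‖ := by
    refine le_of_sq_le_sq ?_ (norm_nonneg _)
    rw [← normSq_eq_norm_sq, ← normSq_eq_norm_sq, normSq_apply, normSq_apply]
    simp only [add_re, ofReal_re, add_im, ofReal_im, add_zero]
    nlinarith
  have hA0 : 0 < ‖A‖ := norm_pos_iff.2 (by rintro h; rw [h] at hApos; simp at hApos)
  have hm₁ : ‖z₁ w‖ ∈ Ioo (0 : ℝ) 1 := ⟨norm_pos_iff.2 hz₁w, hn₁ w hwε⟩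
  have hm₂ : ‖z₂ w‖ ∈ Ioo (0 : ℝ) 1 := ⟨norm_pos_iff.2 hz₂w, hn₂ w hwε⟩
  have heqA : φ ‖z₁ w‖ * ‖A‖ = φ ‖z₂ w‖ * ‖A + s‖ := by
    rw [← hlog₂, hAdef]
    simp only [norm_div, norm_mul]
    linear_combination ‖w‖ * heq w ⟨hwε, hw0⟩
  have hle : ‖z₂ w‖ ≤ ‖z₁ w‖ := by
    rw [← hφ.le_iff_le hm₂ hm₁]
    refine le_of_mul_le_mul_right ?_ hA0
    rw [heqA]
    exact mul_le_mul_of_nonneg_left hnorm (hφ0 _ hm₂).le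
  have hq1 : ‖q w‖ ≤ 1 := by
    rw [hzq w hwε, norm_mul] at hle
    exact le_of_mul_le_mul_left (by linarith) hm₁.1
  filter_upwards [closedBall_mem_nhds (0 : ℂ) hr0] with x hx
  rw [hzq x (hsub hx), norm_mul]
  have h3 := hwmax hx
  simp only [mem_ofPred_eq, Function.comp] at h3
  exact mul_le_of_le_one_right (norm_nonneg _) (h3.trans hq1)

/-- Coordinates in which a metric takes a given rotationally symmetric form are unique up to
rotation. -/
lemma exists_rotation_of_radial {φ : ℝ → ℝ} (hφ : StrictMonoOn φ (Ioo 0 1))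
    (hφ0 : ∀ t ∈ Ioo (0 : ℝ) 1, 0 < φ t) {ε : ℝ} (hε : 0 < ε) {z₁ z₂ : ℂ → ℂ}
    (h₁ : IsCenteredCoordinate z₁ (ball 0 ε)) (h₂ : IsCenteredCoordinate z₂ (ball 0 ε))
    (hn₁ : ∀ w ∈ ball (0 : ℂ) ε, ‖z₁ w‖ < 1) (hn₂ : ∀ w ∈ ball (0 : ℂ) ε, ‖z₂ w‖ < 1)
    (heq : ∀ w ∈ ball (0 : ℂ) ε \ {0},
      φ ‖z₁ w‖ / ‖z₁ w‖ * ‖deriv z₁ w‖ = φ ‖z₂ w‖ / ‖z₂ w‖ * ‖deriv z₂ w‖) :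
    ∃ c : ℂ, ‖c‖ = 1 ∧ ∀ w ∈ ball (0 : ℂ) ε, z₂ w = c * z₁ w := by
  have hball : ball (0 : ℂ) ε ∈ 𝓝 (0 : ℂ) := ball_mem_nhds _ hε
  have hle := eventually_norm_le_of_radial hφ hφ0 hε h₁ h₂ hn₁ hn₂ heq
  have hge := eventually_norm_le_of_radial hφ hφ0 hε h₂ h₁ hn₂ hn₁ fun w hw => (heq w hw).symm
  set q : ℂ → ℂ := fun w => dslope z₂ 0 w / dslope z₁ 0 w with hq
  have hqd : ∀ᶠ w in 𝓝 (0 : ℂ), DifferentiableAt ℂ q w := by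
    have a₁ : AnalyticAt ℂ (dslope z₁ 0) 0 :=
      ((Complex.differentiableOn_dslope hball).2 h₁.holomorphic).analyticAt hball
    have a₂ : AnalyticAt ℂ (dslope z₂ 0) 0 :=
      ((Complex.differentiableOn_dslope hball).2 h₂.holomorphic).analyticAt hball
    have : AnalyticAt ℂ q 0 := a₂.div a₁ (by rw [dslope_same]; exact h₁.deriv_ne_zero)
    exact this.eventually_analyticAt.mono fun w hw => hw.differentiableAt
  have hzq : ∀ w ∈ ball (0 : ℂ) ε, w ≠ 0 → q w = z₂ w / z₁ w := by
    intro w _ hw0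
    rw [hq]
    simp only
    rw [dslope_of_ne _ hw0, dslope_of_ne _ hw0, slope_def_field, slope_def_field, h₁.map_zero,
      h₂.map_zero]
    simp only [sub_zero]
    rw [div_div_div_cancel_right₀ hw0]
  have hone : ∀ᶠ w in 𝓝[≠] (0 : ℂ), ‖q w‖ = 1 := by
    filter_upwards [(hle.and (hge.and hball)).filter_mono nhdsWithin_le_nhds,
      self_mem_nhdsWithin] with w ⟨e1, e2, e3⟩ e4
    rw [hzq w e3 e4, norm_div, le_antisymm e1 e2,
      div_self (norm_ne_zero_iff.2 (h₁.ne_zero e3 e4))]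
  have hone0 : ‖q 0‖ = 1 := by
    have hc := hqd.self_of_nhds.continuousAt.norm.tendsto.mono_left
      (nhdsWithin_le_nhds (s := {(0 : ℂ)}ᶜ))
    exact tendsto_nhds_unique hc (tendsto_const_nhds.congr' (hone.mono fun w hw => hw.symm))
  have hmax : IsLocalMax (norm ∘ q) 0 := by
    have : ∀ᶠ w in 𝓝 (0 : ℂ), w ≠ 0 → ‖q w‖ = 1 := eventually_nhdsWithin_iff.1 hone
    filter_upwards [this] with w hw
    simp only [Function.comp, hone0]
    by_cases hw0 : w = 0
    · rw [hw0, hone0]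
    · exact (hw hw0).le
  have hconst := Complex.eventually_eq_of_isLocalMax_norm hqd hmax
  refine ⟨q 0, hone0, ?_⟩
  have hev : z₂ =ᶠ[𝓝 0] fun w => q 0 * z₁ w := by
    filter_upwards [hconst, hball] with w e1 e2
    by_cases hw0 : w = 0
    · rw [hw0, h₁.map_zero, h₂.map_zero, mul_zero]
    · rw [← e1, hzq w e2 hw0, div_mul_cancel₀ _ (h₁.ne_zero e2 hw0)]
  exact (h₂.holomorphic.analyticOnNhd isOpen_ball).eqOn_of_preconnected_of_eventuallyEq
    ((h₁.holomorphic.const_mul _).analyticOnNhd isOpen_ball)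
    (convex_ball _ _).isPreconnected (mem_ball_self hε) hev

/-! ### Conical and cuspidal normal coordinates -/

lemma mem_puncturedDisk_of_le {ε : ℝ} (hε : ε ≤ 1) {w : ℂ} (hw : w ∈ ball (0 : ℂ) ε \ {0}) :
    w ∈ puncturedDisk :=
  ⟨ball_subset_ball hε hw.1, hw.2⟩

/-- A coordinate on a disk that never reaches the unit circle stays inside it. -/
lemma IsCenteredCoordinate.norm_lt_one {z : ℂ → ℂ} {ε : ℝ}
    (hz : IsCenteredCoordinate z (ball 0 ε)) (h : ∀ w ∈ ball (0 : ℂ) ε \ {0}, ‖z w‖ ≠ 1) :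
    ∀ w ∈ ball (0 : ℂ) ε, ‖z w‖ < 1 := by
  intro w hw
  by_contra hlt
  have h0 : ‖z 0‖ = 0 := by rw [hz.map_zero, norm_zero]
  obtain ⟨x, hx, hx1⟩ := (convex_ball (0 : ℂ) ε).isPreconnected.intermediate_value hz.zero_mem hw
    hz.holomorphic.continuousOn.norm (show (1 : ℝ) ∈ Icc ‖z 0‖ ‖z w‖ from
      ⟨by rw [h0]; exact zero_le_one, not_lt.1 hlt⟩)
  refine h x ⟨hx, ?_⟩ hx1
  rintro rfl
  simp only at hx1
  rw [h0] at hx1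
  exact zero_ne_one hx1

lemma IsCenteredCoordinate.mono {z : ℂ → ℂ} {ε ε' : ℝ} (hz : IsCenteredCoordinate z (ball 0 ε))
    (h0 : 0 < ε') (h : ε' ≤ ε) : IsCenteredCoordinate z (ball 0 ε') :=
  ⟨isOpen_ball, mem_ball_self h0, hz.holomorphic.mono (ball_subset_ball h),
    hz.injective.mono (ball_subset_ball h), hz.map_zero⟩

lemma IsCenteredCoordinate.rotate {z z' : ℂ → ℂ} {ε : ℝ} (hz : IsCenteredCoordinate z (ball 0 ε))
    {c : ℂ} (hc : ‖c‖ = 1) (h : ∀ w ∈ ball (0 : ℂ) ε, z' w = c * z w) :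
    IsCenteredCoordinate z' (ball 0 ε) := by
  have hc0 : c ≠ 0 := by rintro rfl; simp at hc
  refine ⟨isOpen_ball, hz.zero_mem, (hz.holomorphic.const_mul c).congr h, fun x hx y hy hxy => ?_,
    by rw [h 0 hz.zero_mem, hz.map_zero, mul_zero]⟩
  rw [h x hx, h y hy] at hxy
  exact hz.injective hx hy (mul_left_cancel₀ hc0 hxy)

lemma norm_deriv_rotate {z z' : ℂ → ℂ} {ε : ℝ} {c : ℂ} (hc : ‖c‖ = 1)
    (h : ∀ w ∈ ball (0 : ℂ) ε, z' w = c * z w) {w : ℂ} (hw : w ∈ ball (0 : ℂ) ε) :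
    ‖z' w‖ = ‖z w‖ ∧ ‖deriv z' w‖ = ‖deriv z w‖ := by
  constructor
  · rw [h w hw, norm_mul, hc, one_mul]
  · have : z' =ᶠ[𝓝 w] fun x => c * z x := by
      filter_upwards [isOpen_ball.mem_nhds hw] with x hx using h x hx
    rw [this.deriv_eq, deriv_const_mul_field, norm_mul, hc, one_mul]

/-- The uniqueness statement for a metric `(φ(|z|) / |z|)² |dz|²`. -/
lemma radial_coordinate_iff {φ : ℝ → ℝ} (hφ : StrictMonoOn φ (Ioo 0 1))
    (hφ0 : ∀ t ∈ Ioo (0 : ℝ) 1, 0 < φ t) {ρ : ℂ → ℝ} {τ : ℝ → ℝ}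
    (hτ : ∀ t ∈ Ioo (0 : ℝ) 1, τ t = (φ t / t) ^ 2)
    (hτ1 : ∀ z : ℂ → ℂ, ∀ ε ≤ 1, IsCenteredCoordinate z (ball 0 ε) →
      MetricEqInCoordinate ρ (ball 0 ε) z (fun w => τ ‖z w‖) → ∀ w ∈ ball (0 : ℂ) ε, ‖z w‖ < 1)
    {ε : ℝ} (hε1 : ε ≤ 1) {z : ℂ → ℂ} (hz : IsCenteredCoordinate z (ball 0 ε))
    (hm : MetricEqInCoordinate ρ (ball 0 ε) z (fun w => τ ‖z w‖)) {ε' : ℝ} (h0 : 0 < ε')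
    (hle : ε' ≤ ε) (z' : ℂ → ℂ) :
    (IsCenteredCoordinate z' (ball 0 ε') ∧
      MetricEqInCoordinate ρ (ball 0 ε') z' (fun w => τ ‖z' w‖)) ↔
    ∃ c : ℂ, ‖c‖ = 1 ∧ ∀ w ∈ ball (0 : ℂ) ε', z' w = c * z w := by
  have hsub : ball (0 : ℂ) ε' ⊆ ball 0 ε := ball_subset_ball hle
  have hzr := hz.mono h0 hle
  constructor
  · rintro ⟨hz', hm'⟩
    have hn := hτ1 z ε hε1 hz hm
    have hn' := hτ1 z' ε' (hle.trans hε1) hz' hm'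
    refine exists_rotation_of_radial hφ hφ0 h0 hzr hz' (fun w hw => hn w (hsub hw)) hn'
      fun w hw => ?_
    have hI : ‖z w‖ ∈ Ioo (0 : ℝ) 1 :=
      ⟨norm_pos_iff.2 (hzr.ne_zero hw.1 hw.2), hn w (hsub hw.1)⟩
    have hI' : ‖z' w‖ ∈ Ioo (0 : ℝ) 1 := ⟨norm_pos_iff.2 (hz'.ne_zero hw.1 hw.2), hn' w hw.1⟩
    have e1 := hm w ⟨hsub hw.1, hw.2⟩
    have e2 := hm' w hw
    simp only [hτ _ hI, hτ _ hI', ← mul_pow] at e1 e2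
    have p1 := div_pos (hφ0 _ hI) hI.1
    have p2 := div_pos (hφ0 _ hI') hI'.1
    exact (pow_left_inj₀ (by positivity) (by positivity) two_ne_zero).1 (e1.symm.trans e2)
  · rintro ⟨c, hc, h⟩
    refine ⟨hzr.rotate hc h, fun w hw => ?_⟩
    obtain ⟨e1, e2⟩ := norm_deriv_rotate hc h hw.1
    simp only [e1, e2]
    exact hm w ⟨hsub hw.1, hw.2⟩

lemma conical_strictMonoOn {α : ℝ} (hα : 0 < α) :
    StrictMonoOn (fun t : ℝ => 2 * α * t ^ α / (1 - t ^ (2 * α))) (Ioo 0 1) := by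
  intro s hs t ht hst
  have h1 : s ^ α < t ^ α := Real.rpow_lt_rpow hs.1.le hst hα
  have h2 : s ^ (2 * α) < t ^ (2 * α) := Real.rpow_lt_rpow hs.1.le hst (by positivity)
  have h3 : t ^ (2 * α) < 1 := Real.rpow_lt_one ht.1.le ht.2 (by positivity)
  have h4 : 0 < s ^ α := Real.rpow_pos_of_pos hs.1 α
  simp only
  have h5 : 0 < 1 - t ^ (2 * α) := by linarith
  have h6 : 0 < t ^ α := h4.trans h1
  gcongr

lemma conical_pos {α : ℝ} (hα : 0 < α) :
    ∀ t ∈ Ioo (0 : ℝ) 1, 0 < 2 * α * t ^ α / (1 - t ^ (2 * α)) := by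
  intro t ht
  have h3 : t ^ (2 * α) < 1 := Real.rpow_lt_one ht.1.le ht.2 (by positivity)
  have h4 : 0 < t ^ α := Real.rpow_pos_of_pos ht.1 α
  have h5 : 0 < 1 - t ^ (2 * α) := by linarith
  positivity

lemma conical_density_eq {α : ℝ} {t : ℝ} (ht : t ∈ Ioo (0 : ℝ) 1) :
    4 * α ^ 2 * t ^ (2 * α - 2) / (1 - t ^ (2 * α)) ^ 2 =
      ((2 * α * t ^ α / (1 - t ^ (2 * α))) / t) ^ 2 := by
  have h1 : t ^ (2 * α - 2) = (t ^ α) ^ 2 / t ^ 2 := by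
    rw [Real.rpow_sub ht.1, mul_comm 2 α, Real.rpow_mul ht.1.le, Real.rpow_two, Real.rpow_two]
  rw [h1]
  generalize 1 - t ^ (2 * α) = d
  ring

lemma cusp_strictMonoOn : StrictMonoOn (fun t : ℝ => (-Real.log t)⁻¹) (Ioo 0 1) := by
  intro s hs t ht hst
  have h1 := Real.log_lt_log hs.1 hst
  have h2 := Real.log_neg ht.1 ht.2
  exact inv_strictAnti₀ (by linarith) (by linarith)

lemma cusp_pos : ∀ t ∈ Ioo (0 : ℝ) 1, 0 < (-Real.log t)⁻¹ := fun t ht =>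
  inv_pos.2 (by linarith [Real.log_neg ht.1 ht.2])

/-- At `|z| = 1` the denominator of the conical density is `0`; as division by `0` gives `0`, the
metric would vanish there. -/
lemma norm_lt_one_of_conical {ρ : ℂ → ℝ} (hρ : ∀ w ∈ puncturedDisk, 0 < ρ w) {α : ℝ}
    {z : ℂ → ℂ} {ε : ℝ} (hε : ε ≤ 1) (hz : IsCenteredCoordinate z (ball 0 ε))
    (hm : MetricEqInCoordinate ρ (ball 0 ε) z
      (fun w => 4 * α ^ 2 * ‖z w‖ ^ (2 * α - 2) / (1 - ‖z w‖ ^ (2 * α)) ^ 2)) :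
    ∀ w ∈ ball (0 : ℂ) ε, ‖z w‖ < 1 := by
  refine hz.norm_lt_one fun w hw h1 => ?_
  have := hm w hw
  simp only [h1, Real.one_rpow, sub_self, ne_eq, OfNat.ofNat_ne_zero, not_false_eq_true, zero_pow,
    div_zero, zero_mul] at this
  exact (hρ w (mem_puncturedDisk_of_le hε hw)).ne' this

/-- At `|z| = 1` the factor `(log |z|)⁻²` is `0⁻¹ = 0`, so the metric would vanish there. -/
lemma norm_lt_one_of_cusp {ρ : ℂ → ℝ} (hρ : ∀ w ∈ puncturedDisk, 0 < ρ w)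
    {z : ℂ → ℂ} {ε : ℝ} (hε : ε ≤ 1) (hz : IsCenteredCoordinate z (ball 0 ε))
    (hm : MetricEqInCoordinate ρ (ball 0 ε) z
      (fun w => (‖z w‖ ^ 2)⁻¹ * (Real.log ‖z w‖ ^ 2)⁻¹)) :
    ∀ w ∈ ball (0 : ℂ) ε, ‖z w‖ < 1 := by
  refine hz.norm_lt_one fun w hw h1 => ?_
  have := hm w hw
  simp only [h1, Real.log_one, ne_eq, OfNat.ofNat_ne_zero, not_false_eq_true, zero_pow, inv_zero,
    mul_zero, zero_mul] at this
  exact (hρ w (mem_puncturedDisk_of_le hε hw)).ne' this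

lemma IsConicalNormalCoordinate.hasConicalSingularity {ρ : ℂ → ℝ}
    (hρ : ∀ w ∈ puncturedDisk, 0 < ρ w) {α ε : ℝ} {z : ℂ → ℂ} (hα : 0 < α)
    (h : IsConicalNormalCoordinate ρ α ε z) : HasConicalSingularity ρ α := by
  obtain ⟨hε0, hε1, hz, hm⟩ := h
  have hn := norm_lt_one_of_conical hρ hε1 hz hm
  have hlt : ∀ w ∈ ball (0 : ℂ) ε, 0 < 1 - ‖z w‖ ^ (2 * α) := fun w hw => by
    have := Real.rpow_lt_one (norm_nonneg (z w)) (hn w hw) (by positivity : 0 < 2 * α)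
    linarith
  refine ⟨hα, ball 0 ε, z, fun w => Real.log (2 * α) + (α - 1) * Real.log ‖z w‖ -
    Real.log (1 - ‖z w‖ ^ (2 * α)), ball_subset_ball hε1, hz, fun w hw => ?_,
    fun w => Real.log (2 * α) - Real.log (1 - ‖z w‖ ^ (2 * α)), ?_, fun w _ => by ring⟩
  · rw [hm w hw]
    congr 1
    have hz0 : 0 < ‖z w‖ := norm_pos_iff.2 (hz.ne_zero hw.1 hw.2)
    have h1 := hlt w hw.1
    have h2 : 2 * (Real.log (2 * α) + (α - 1) * Real.log ‖z w‖ - Real.log (1 - ‖z w‖ ^ (2 * α))) =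
        Real.log (2 * α) + Real.log (2 * α) + Real.log ‖z w‖ * (2 * α - 2) -
          (Real.log (1 - ‖z w‖ ^ (2 * α)) + Real.log (1 - ‖z w‖ ^ (2 * α))) := by ring
    beta_reduce
    rw [h2, Real.exp_sub, Real.exp_add, Real.exp_add, Real.exp_add, Real.exp_log h1,
      Real.exp_log (by positivity), ← Real.rpow_def_of_pos hz0]
    generalize 1 - ‖z w‖ ^ (2 * α) = d
    ring
  · refine continuousOn_const.sub (ContinuousOn.log ?_ fun w hw => (hlt w hw).ne')
    exact continuousOn_const.sub
      (hz.holomorphic.continuousOn.norm.rpow_const fun w _ => Or.inr (by positivity))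

lemma IsCuspNormalCoordinate.hasCuspSingularity {ρ : ℂ → ℝ}
    (hρ : ∀ w ∈ puncturedDisk, 0 < ρ w) {ε : ℝ} {z : ℂ → ℂ}
    (h : IsCuspNormalCoordinate ρ ε z) : HasCuspSingularity ρ := by
  obtain ⟨hε0, hε1, hz, hm⟩ := h
  have hn := norm_lt_one_of_cusp hρ hε1 hz hm
  refine ⟨ball 0 ε, z, fun w => -Real.log ‖z w‖ - Real.log (-Real.log ‖z w‖),
    ball_subset_ball hε1, hz, hn, fun w hw => ?_, fun _ => 0, continuousOn_const,
    fun w _ => by ring⟩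
  rw [hm w hw]
  congr 1
  have hz0 : 0 < ‖z w‖ := norm_pos_iff.2 (hz.ne_zero hw.1 hw.2)
  have hlog : 0 < -Real.log ‖z w‖ := by linarith [Real.log_neg hz0 (hn w hw.1)]
  have h2 : 2 * (-Real.log ‖z w‖ - Real.log (-Real.log ‖z w‖)) =
      -(Real.log ‖z w‖ + Real.log ‖z w‖ +
        (Real.log (-Real.log ‖z w‖) + Real.log (-Real.log ‖z w‖))) := by ring
  beta_reduce
  rw [h2, Real.exp_neg, Real.exp_add, Real.exp_add, Real.exp_add, Real.exp_log hz0,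
    Real.exp_log hlog, ← mul_inv]
  ring

theorem theorem1p2 (ρ : ℂ → ℝ) (hρ : IsConformalHyperbolicMetric ρ puncturedDisk) :
    Xor (∃ α : ℝ, HasConicalSingularity ρ α) (HasCuspSingularity ρ) ∧
    (∀ α : ℝ, HasConicalSingularity ρ α →
      (∃ (ε : ℝ) (z : ℂ → ℂ), IsConicalNormalCoordinate ρ α ε z) ∧
      (∀ (ε : ℝ) (z : ℂ → ℂ), IsConicalNormalCoordinate ρ α ε z →
        ∀ (ε' : ℝ) (z' : ℂ → ℂ), 0 < ε' → ε' ≤ ε →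
          (IsConicalNormalCoordinate ρ α ε' z' ↔
            ∃ c : ℂ, ‖c‖ = 1 ∧ ∀ w ∈ Metric.ball (0 : ℂ) ε', z' w = c * z w))) ∧
    (HasCuspSingularity ρ →
      (∃ (ε : ℝ) (z : ℂ → ℂ), IsCuspNormalCoordinate ρ ε z) ∧
      (∀ (ε : ℝ) (z : ℂ → ℂ), IsCuspNormalCoordinate ρ ε z →
        ∀ (ε' : ℝ) (z' : ℂ → ℂ), 0 < ε' → ε' ≤ ε →
          (IsCuspNormalCoordinate ρ ε' z' ↔
            ∃ c : ℂ, ‖c‖ = 1 ∧ ∀ w ∈ Metric.ball (0 : ℂ) ε', z' w = c * z w))) := by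
  have hangle : ∀ α β, HasConicalSingularity ρ α → HasConicalSingularity ρ β → α = β :=
    fun α β h₁ h₂ => by linarith [tendsto_nhds_unique h₁.tendsto h₂.tendsto]
  have hexcl : ∀ α, HasConicalSingularity ρ α → ¬ HasCuspSingularity ρ := fun α h₁ h₂ => by
    linarith [h₁.1, tendsto_nhds_unique h₁.tendsto h₂.tendsto]
  have hcases := hρ.exists_normalCoordinate
  refine ⟨?_, fun α hα => ⟨?_, fun ε z hz ε' z' h0 hle => ?_⟩,
    fun hcusp => ⟨?_, fun ε z hz ε' z' h0 hle => ?_⟩⟩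
  · rcases hcases with ⟨α, ε, z, hα, hz⟩ | ⟨ε, z, hz⟩
    · have h := hz.hasConicalSingularity hρ.pos hα
      exact Or.inl ⟨⟨α, h⟩, hexcl α h⟩
    · have h := hz.hasCuspSingularity hρ.pos
      exact Or.inr ⟨h, fun ⟨α, hα⟩ => hexcl α hα h⟩
  · rcases hcases with ⟨β, ε, z, hβ, hz⟩ | ⟨ε, z, hz⟩
    · obtain rfl := hangle α β hα (hz.hasConicalSingularity hρ.pos hβ)
      exact ⟨ε, z, hz⟩
    · exact absurd (hz.hasCuspSingularity hρ.pos) (hexcl α hα)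
  · obtain ⟨-, hε1, hc, hm⟩ := hz
    have := radial_coordinate_iff (conical_strictMonoOn hα.1) (conical_pos hα.1)
      (τ := fun t => 4 * α ^ 2 * t ^ (2 * α - 2) / (1 - t ^ (2 * α)) ^ 2)
      (fun t ht => conical_density_eq ht)
      (fun z ε hε hz hm => norm_lt_one_of_conical hρ.pos hε hz hm) hε1 hc hm h0 hle z'
    rw [← this]
    exact ⟨fun h => h.2.2, fun h => ⟨h0, hle.trans hε1, h⟩⟩
  · rcases hcases with ⟨β, ε, z, hβ, hz⟩ | ⟨ε, z, hz⟩
    · exact absurd hcusp (hexcl β (hz.hasConicalSingularity hρ.pos hβ))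
    · exact ⟨ε, z, hz⟩
  · obtain ⟨-, hε1, hc, hm⟩ := hz
    have := radial_coordinate_iff cusp_strictMonoOn cusp_pos
      (τ := fun t => (t ^ 2)⁻¹ * (Real.log t ^ 2)⁻¹)
      (fun t _ => by rw [div_pow, inv_pow, neg_sq, div_eq_mul_inv, mul_comm])
      (fun z ε hε hz hm => norm_lt_one_of_cusp hρ.pos hε hz hm) hε1 hc hm h0 hle z'
    rw [← this]
    exact ⟨fun h => h.2.2, fun h => ⟨h0, hle.trans hε1, h⟩⟩
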